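/- **Theorem (Darboux transformation of degree $2n$ for the nonlocal derivative nonlinear Schrödinger equation).** Let $\varepsilon=\pm1$, let ${}^*$ denote complex conjugation, ${}^\dagger$ conjugate transpose, and write $\bar f(x,t)=f(-x,t)$. Let $2\le k\le\infty$, let $\Omega\subseteq\mathbb R^2$ be open and invariant under $(x,t)\mapsto(-x,t)$, and let $q:\Omega\to\mathbb C$ be a $C^k$ solution of $$ i q_t=q_{xx}+\varepsilon\,(q^2\bar q^{*})_x. \tag{1}$$ For functions $q,r$ and $\lambda\in\mathbb C$ consider the Lax pair $\Phi_x=U\Phi$, $\Phi_t=V\Phi$ with $$U=\begin{pmatrix}\lambda^2&\lambda q\\ \lambda r&-\lambda^2\end{pmatrix},\qquad V=\begin{pmatrix}-2i\lambda^4+iqr\lambda^2&-2iq\lambda^3+(-iq_x+iq^2r)\lambda\\ -2ir\lambda^3+(ir_x+iqr^2)\lambda&2i\lambda^4-iqr\lambda^2\end{pmatrix},\qquad r=-\varepsilon\bar q^{*}.$$ Let $\mu_1,\dots,\mu_n\in\mathbb C$ be such that no $\mu_j^2$ is real and $\mu_i^{*2}\neq\mu_j^2$ for $i\ne j$. For each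 $j$ let $(\xi_j,\eta_j)^T$ be a (differentiable) solution on $\Omega$ of the Lax pair with $\lambda=\mu_j$. Put $\lambda_{2j-1}=\mu_j$, $\lambda_{2j}=-\mu_j$, $h_{2j-1}=(\xi_j,\eta_j)^T$, $h_{2j}=(\xi_j,-\eta_j)^T$, denote by $\xi_\alpha,\eta_\alpha$ $(1\le\alpha\le 2n)$ in the sums below the two entries of $h_\alpha$, and let $L=\operatorname{diag}(\varepsilon,1)$, $$\Gamma_{\alpha\beta}=\frac{\bar h_\alpha^\dagger L h_\beta}{\lambda_\alpha^*+\lambda_\beta}\quad(1\le\alpha,\beta\le 2n).$$ Let $\Omega'\subseteq\Omega$ be the set of points at which $\Gamma$ is invertible, and define on $\Omega'$ $$F=I-\sum_{\alpha,\beta=1}^{2n}\frac{(\Gamma^{-1})_{\alpha\beta}h_\alpha\bar h_\beta^\dagger L}{\lambda_\beta^*},\qquad G(\lambda)=\prod_{\gamma=1}^{2n}(\lambda+\lambda_\gamma^*)\; F^{-1}\Big(I-\sum_{\alpha,\beta=1}^{2n}\frac{(\Gamma^{-1})_{\alpha\beta}h_\alpha\bar h_\beta^\dagger L}{\lambda+\lambda_\beta^*}\Big),$$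 $$\widetilde q=\frac{1-\sum_{\alpha,\beta=1}^{2n}(\Gamma^{-1})_{\alpha\beta}\,\eta_\alpha\bar\eta_\beta^*/\lambda_\beta^*}{1-\varepsilon\sum_{\alpha,\beta=1}^{2n}(\Gamma^{-1})_{\alpha\beta}\,\xi_\alpha\bar\xi_\beta^*/\lambda_\beta^*}\Big(q+2\sum_{\alpha,\beta=1}^{2n}(\Gamma^{-1})_{\alpha\beta}\,\xi_\alpha\bar\eta_\beta^*\Big).$$ Then: 1. $\Omega'$ is open and invariant under $(x,t)\mapsto(-x,t)$. 2. On $\Omega'$ the matrix $F$ is diagonal and invertible (so $G$ and $\widetilde q$ are well defined). 3. $G(\lambda)$ is a polynomial in $\lambda$ of degree $2n$ with leading coefficient $F^{-1}$ and with coefficients of class $C^k$ on $\Omega'$, and it is a Darboux matrix preserving the nonlocal reduction: with $\widetilde U,\widetilde V$ the matrices $U,V$ in which $(q,r)$ is replaced by $(\widetilde q,\widetilde r)$, $\widetilde r=-\varepsilon\bar{\widetilde q}^{\,*}$, one has on $\Omega'$, for all $\lambda\in\mathbb C$, $$G U+G_x=\widetilde U G,\qquad G V+G_t=\widetilde V G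 .$$ 4. $\widetilde q$ is a $C^k$ solution of (1) on $\Omega'$. -/

import Mathlib

open scoped ComplexConjugate

noncomputable section

namespace NonlocalDNLS

/-- The partial derivative in the first variable `x` of a function of `(x, t)`. -/
def dx (f : ℝ × ℝ → ℂ) (p : ℝ × ℝ) : ℂ := deriv (fun s : ℝ => f (s, p.2)) p.1

/-- The partial derivative in the second variable `t` of a function of `(x, t)`. -/
def dt (f : ℝ × ℝ → ℂ) (p : ℝ × ℝ) : ℂ := deriv (fun s : ℝ => f (p.1, s)) p.2

/-- The entrywise partial `x`-derivative of a matrix function. -/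
def matDx (G : ℝ × ℝ → Matrix (Fin 2) (Fin 2) ℂ) (p : ℝ × ℝ) : Matrix (Fin 2) (Fin 2) ℂ :=
  Matrix.of fun i j => dx (fun p' => G p' i j) p

/-- The entrywise partial `t`-derivative of a matrix function. -/
def matDt (G : ℝ × ℝ → Matrix (Fin 2) (Fin 2) ℂ) (p : ℝ × ℝ) : Matrix (Fin 2) (Fin 2) ℂ :=
  Matrix.of fun i j => dt (fun p' => G p' i j) p

/-- The space reflection `(x, t) ↦ (-x, t)`. -/
def reflect (p : ℝ × ℝ) : ℝ × ℝ := (-p.1, p.2)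

/-- The function `(x, t) ↦ f(-x, t)^*`. -/
def barConj (f : ℝ × ℝ → ℂ) (p : ℝ × ℝ) : ℂ := conj (f (reflect p))

/-- `q` is a solution of class `C^k` (where `2 ≤ k` in all uses) on the open set `Ω` of the nonlocal
derivative nonlinear Schrödinger equation `i q_t = q_xx + ε (q(x,t)² q(-x,t)^*)_x`. -/
def IsSolution (k : ℕ∞) (ε : ℂ) (q : ℝ × ℝ → ℂ) (Ω : Set (ℝ × ℝ)) : Prop :=
  ContDiffOn ℝ (k : WithTop ℕ∞) q Ω ∧
    ∀ p ∈ Ω, Complex.I * dt q p =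
      dx (dx q) p + ε * dx (fun p' => q p' ^ 2 * barConj q p') p

/-- The second potential `r(x,t) = -ε q(-x,t)^*` given by the nonlocal reduction. -/
def reduction (ε : ℂ) (q : ℝ × ℝ → ℂ) (p : ℝ × ℝ) : ℂ := -ε * barConj q p

/-- The matrix `U` of the Lax pair `Φ_x = U Φ`, `Φ_t = V Φ` with potentials `q`, `r`. -/
def laxU (q r : ℝ × ℝ → ℂ) (z : ℂ) (p : ℝ × ℝ) : Matrix (Fin 2) (Fin 2) ℂ :=
  !![z ^ 2, z * q p;
     z * r p, -z ^ 2]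

/-- The matrix `V` of the Lax pair `Φ_x = U Φ`, `Φ_t = V Φ` with potentials `q`, `r`. -/
def laxV (q r : ℝ × ℝ → ℂ) (z : ℂ) (p : ℝ × ℝ) : Matrix (Fin 2) (Fin 2) ℂ :=
  !![-2 * Complex.I * z ^ 4 + Complex.I * q p * r p * z ^ 2,
      -2 * Complex.I * q p * z ^ 3 +
        (-Complex.I * dx q p + Complex.I * q p ^ 2 * r p) * z;
     -2 * Complex.I * r p * z ^ 3 +
        (Complex.I * dx r p + Complex.I * q p * r p ^ 2) * z,
      2 * Complex.I * z ^ 4 - Complex.I * q p * r p * z ^ 2]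

/-- `(ξ, η)ᵀ` solves on `Ω` the Lax pair with potentials `q`, `r` and spectral parameter `z`. -/
def IsLaxSolution (q r : ℝ × ℝ → ℂ) (z : ℂ) (ξ η : ℝ × ℝ → ℂ) (Ω : Set (ℝ × ℝ)) : Prop :=
  DifferentiableOn ℝ ξ Ω ∧ DifferentiableOn ℝ η Ω ∧
    ∀ p ∈ Ω,
      ![dx ξ p, dx η p] = (laxU q r z p).mulVec ![ξ p, η p] ∧
      ![dt ξ p, dt η p] = (laxV q r z p).mulVec ![ξ p, η p]

/-- `G(λ)` is, on `Ω`, a Darboux matrix from the Lax pair with potentials `q`, `r` to the Lax pair of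
the same form with potentials `q'`, `r'`: for every `λ` one has `G U + G_x = U' G` and
`G V + G_t = V' G`, so that `Φ ↦ G(λ) Φ` takes solutions to solutions. -/
def IsDarboux (G : ℂ → ℝ × ℝ → Matrix (Fin 2) (Fin 2) ℂ) (q r q' r' : ℝ × ℝ → ℂ)
    (Ω : Set (ℝ × ℝ)) : Prop :=
  ∀ z : ℂ, (∀ i j, DifferentiableOn ℝ (fun p => G z p i j) Ω) ∧
    ∀ p ∈ Ω,
      G z p * laxU q r z p + matDx (G z) p = laxU q' r' z p * G z p ∧
      G z p * laxV q r z p + matDt (G z) p = laxV q' r' z p * G z p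

/-! The index `α ∈ {1, …, 2n}` is encoded by a pair in `Fin n × Fin 2`: `2j-1` is `(j, 0)` and
`2j` is `(j, 1)`. -/

/-- `λ_{2j-1} = μ_j`, `λ_{2j} = -μ_j`. -/
def lam {n : ℕ} (μ : Fin n → ℂ) (α : Fin n × Fin 2) : ℂ := if α.2 = 0 then μ α.1 else -μ α.1

/-- First entries of the `h_α`: `ξ_{2j-1} = ξ_{2j} = ξ_j`. -/
def xiOf {n : ℕ} (ξ : Fin n → ℝ × ℝ → ℂ) (α : Fin n × Fin 2) : ℝ × ℝ → ℂ := ξ α.1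

/-- Second entries of the `h_α`: `η_{2j-1} = η_j`, `η_{2j} = -η_j`. -/
def etaOf {n : ℕ} (η : Fin n → ℝ × ℝ → ℂ) (α : Fin n × Fin 2) : ℝ × ℝ → ℂ :=
  fun p => if α.2 = 0 then η α.1 p else -η α.1 p

/-- The column `h_α = (ξ_α, η_α)ᵀ`, as a `2 × 1` matrix. -/
def hCol {n : ℕ} (ξ η : Fin n → ℝ × ℝ → ℂ) (α : Fin n × Fin 2) (p : ℝ × ℝ) :
    Matrix (Fin 2) (Fin 1) ℂ :=
  !![xiOf ξ α p; etaOf η α p]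

/-- The row `h_α(-x,t)^†`, as a `1 × 2` matrix. -/
def hBarRow {n : ℕ} (ξ η : Fin n → ℝ × ℝ → ℂ) (α : Fin n × Fin 2) (p : ℝ × ℝ) :
    Matrix (Fin 1) (Fin 2) ℂ :=
  (hCol ξ η α (reflect p)).conjTranspose

/-- `L = diag(ε, 1)`. -/
def matL (ε : ℂ) : Matrix (Fin 2) (Fin 2) ℂ := !![ε, 0; 0, 1]

variable {n : ℕ} (ε : ℂ) (μ : Fin n → ℂ) (ξ η : Fin n → ℝ × ℝ → ℂ)

/-- `Γ_{αβ} = h_α(-x,t)^† L h_β / (λ_α^* + λ_β)`. -/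
def Gam (p : ℝ × ℝ) : Matrix (Fin n × Fin 2) (Fin n × Fin 2) ℂ :=
  Matrix.of fun α β =>
    (hBarRow ξ η α p * matL ε * hCol ξ η β p) 0 0 / (conj (lam μ α) + lam μ β)

/-- `F = I - ∑_{α,β} (Γ⁻¹)_{αβ} h_α h_β(-x,t)^† L / λ_β^*`. -/
def matF (p : ℝ × ℝ) : Matrix (Fin 2) (Fin 2) ℂ :=
  1 - ∑ α, ∑ β, ((Gam ε μ ξ η p)⁻¹ α β / conj (lam μ β)) •
    (hCol ξ η α p * hBarRow ξ η β p * matL ε)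

/-- `G(λ) = ∏_γ (λ + λ_γ^*) F⁻¹ (I - ∑_{α,β} (Γ⁻¹)_{αβ} h_α h_β(-x,t)^† L / (λ + λ_β^*))`, for
`λ` (here `z`) different from all `-λ_β^*`. -/
def matG (z : ℂ) (p : ℝ × ℝ) : Matrix (Fin 2) (Fin 2) ℂ :=
  (∏ γ, (z + conj (lam μ γ))) • ((matF ε μ ξ η p)⁻¹ *
    (1 - ∑ α, ∑ β, ((Gam ε μ ξ η p)⁻¹ α β / (z + conj (lam μ β))) •
      (hCol ξ η α p * hBarRow ξ η β p * matL ε)))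

/-- The transformed potential. -/
def newPotential (q : ℝ × ℝ → ℂ) (p : ℝ × ℝ) : ℂ :=
  (1 - ∑ α, ∑ β, (Gam ε μ ξ η p)⁻¹ α β * etaOf η α p * barConj (etaOf η β) p / conj (lam μ β)) /
    (1 - ε * ∑ α, ∑ β,
      (Gam ε μ ξ η p)⁻¹ α β * xiOf ξ α p * barConj (xiOf ξ β) p / conj (lam μ β)) *
    (q p + 2 * ∑ α, ∑ β, (Gam ε μ ξ η p)⁻¹ α β * xiOf ξ α p * barConj (etaOf η β) p)

/-- The part of `Ω` where `Γ` is invertible. -/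
def regularSet (Ω : Set (ℝ × ℝ)) : Set (ℝ × ℝ) := {p ∈ Ω | (Gam ε μ ξ η p).det ≠ 0}

end NonlocalDNLS

end

/-! Collect the columns `h_α` in `H` and the rows `h_α(-x,t)^† L` in `K`, and put `l = λ`, `m =
-λ^*`. Then `Γ` solves the Sylvester equation `Γ diag(l) - diag(m) Γ = K H`, and the bracket in `G`
is the binary Darboux matrix `S(z) = 1 - H Γ⁻¹ (z - diag(m))⁻¹ K`. With `A` equal to `U` or `V`, the
columns evolve by `A(l_α)` and, thanks to `r = -ε q(-x,t)^*`, the rows evolve by the dual flow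
`-A(m_α)`.

A generator `A` is dressed to `W` when `S' + S A = W S`. A constant is dressed to itself, and if `A`
is dressed to `W`, then `z A` is dressed to `z W - S₁'`, where `S₁` is the `z⁻¹` coefficient of `S`
(`IsDressing.shift`). Hence polynomial generators are dressed to polynomial ones, with no residues
to examine. Since `U` and `V` vanish at `z = 0`, the matrix `F = S(0)` satisfies `F' = W(0) F`, and
the gauge `F⁻¹` removes exactly the constant term of `W` (`gauge_intertwine`). What is left has the
Lax form with the new potentials (`gauge_lax`).

Two symmetries enter. Pairing `λ` with `-λ` makes `F` diagonal and `S₁` off-diagonal (`sum_parity`).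
Reflection in `x` combined with conjugate transposition sends `S` to its inverse up to `L`, so
`F_ii(x,t) F_ii(-x,t)^* = 1` (`matF_mul_conj_reflect`), and the new pair obeys the nonlocal
reduction.

The curvature of the Lax pair is `z` times the defects of the evolution equations (`lax_curvature`).
Equality of mixed partials of `F⁻¹ S` carries zero curvature from the old pair to the new one
(`zero_curvature`), because `F⁻¹ S(z)` is invertible for generic `z`. Clearing the denominators of
`S` gives the polynomial `G`; its intertwining relations extend to the poles by density. -/

noncomputable section

namespace NonlocalDNLS

set_option linter.unusedSectionVars false

/-! ### Algebra of binary Darboux dressing -/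

section Dressing

variable {N : Type*} [Fintype N] [DecidableEq N]

/-- The matrix with entries `C α β / (l β - m α)`. -/
def cauchyDiv (l m : N → ℂ) (C : Matrix N N ℂ) : Matrix N N ℂ :=
  Matrix.of fun α β => C α β / (l β - m α)

/-- The solution `Γ` of the Sylvester equation `Γ diag(l) - diag(m) Γ = K H`. -/
def gram (l m : N → ℂ) (H : Matrix (Fin 2) N ℂ) (K : Matrix N (Fin 2) ℂ) : Matrix N N ℂ :=
  cauchyDiv l m (K * H)

/-- The variation of the columns of `H` under the flow with generator `A`. -/
def flowH (l : N → ℂ) (H : Matrix (Fin 2) N ℂ) (A : ℂ → Matrix (Fin 2) (Fin 2) ℂ) :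
    Matrix (Fin 2) N ℂ :=
  Matrix.of fun i α => (A (l α) * H) i α

/-- The variation of the rows of `K` under the dual flow with generator `A`. -/
def flowK (m : N → ℂ) (K : Matrix N (Fin 2) ℂ) (A : ℂ → Matrix (Fin 2) (Fin 2) ℂ) :
    Matrix N (Fin 2) ℂ :=
  Matrix.of fun α j => -(K * A (m α)) α j

/-- The variation of `gram l m H K` under the flow with generator `A`. -/
def flowGram (l m : N → ℂ) (H : Matrix (Fin 2) N ℂ) (K : Matrix N (Fin 2) ℂ)
    (A : ℂ → Matrix (Fin 2) (Fin 2) ℂ) : Matrix N N ℂ :=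
  cauchyDiv l m (flowK m K A * H + K * flowH l H A)

/-- The product `H Γ⁻¹`. -/
def dressX (l m : N → ℂ) (H : Matrix (Fin 2) N ℂ) (K : Matrix N (Fin 2) ℂ) :
    Matrix (Fin 2) N ℂ :=
  H * (gram l m H K)⁻¹

/-- The variation of `H Γ⁻¹` under the flow with generator `A`. -/
def flowX (l m : N → ℂ) (H : Matrix (Fin 2) N ℂ) (K : Matrix N (Fin 2) ℂ)
    (A : ℂ → Matrix (Fin 2) (Fin 2) ℂ) : Matrix (Fin 2) N ℂ :=
  flowH l H A * (gram l m H K)⁻¹ -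
    dressX l m H K * (flowGram l m H K A * (gram l m H K)⁻¹)

/-- The resolvent `(z - diag(m))⁻¹`. -/
def resolv (m : N → ℂ) (z : ℂ) : Matrix N N ℂ := Matrix.diagonal fun α => (z - m α)⁻¹

/-- The dressing matrix `1 - H Γ⁻¹ (z - diag(m))⁻¹ K`. -/
def dressS (l m : N → ℂ) (H : Matrix (Fin 2) N ℂ) (K : Matrix N (Fin 2) ℂ) (z : ℂ) :
    Matrix (Fin 2) (Fin 2) ℂ :=
  1 - dressX l m H K * (resolv m z * K)

/-- The variation of the dressing matrix under the flow with generator `A`. -/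
def flowS (l m : N → ℂ) (H : Matrix (Fin 2) N ℂ) (K : Matrix N (Fin 2) ℂ)
    (A : ℂ → Matrix (Fin 2) (Fin 2) ℂ) (z : ℂ) : Matrix (Fin 2) (Fin 2) ℂ :=
  -(flowX l m H K A * (resolv m z * K)) - dressX l m H K * (resolv m z * flowK m K A)

/-- The dressing matrix intertwines the generators `A` and `W`. -/
def IsDressing (l m : N → ℂ) (H : Matrix (Fin 2) N ℂ) (K : Matrix N (Fin 2) ℂ)
    (A W : ℂ → Matrix (Fin 2) (Fin 2) ℂ) : Prop :=
  ∀ z, (∀ α, z - m α ≠ 0) →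
    flowS l m H K A z + dressS l m H K z * A z = W z * dressS l m H K z

/-- The coefficient of `z⁻¹` in the dressing matrix. -/
def dressOne (l m : N → ℂ) (H : Matrix (Fin 2) N ℂ) (K : Matrix N (Fin 2) ℂ) :
    Matrix (Fin 2) (Fin 2) ℂ := -(dressX l m H K * K)

/-- The variation of the coefficient of `z⁻¹` in the dressing matrix. -/
def flowOne (l m : N → ℂ) (H : Matrix (Fin 2) N ℂ) (K : Matrix N (Fin 2) ℂ)
    (A : ℂ → Matrix (Fin 2) (Fin 2) ℂ) : Matrix (Fin 2) (Fin 2) ℂ :=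
  -(flowX l m H K A * K) - dressX l m H K * flowK m K A

variable {l m : N → ℂ} {H : Matrix (Fin 2) N ℂ} {K : Matrix N (Fin 2) ℂ}
  {A B W W' : ℂ → Matrix (Fin 2) (Fin 2) ℂ}

lemma flowH_add : flowH l H (A + B) = flowH l H A + flowH l H B := by
  ext i α; simp [flowH, Matrix.add_mul]

lemma flowH_smul (c : ℂ) : flowH l H (c • A) = c • flowH l H A := by
  ext i α; simp [flowH]

lemma flowK_add : flowK m K (A + B) = flowK m K A + flowK m K B := by
  ext i α; simp [flowK, Matrix.mul_add]; ring

lemma flowK_smul (c : ℂ) : flowK m K (c • A) = c • flowK m K A := by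
  ext i α; simp [flowK]

lemma cauchyDiv_add (C D : Matrix N N ℂ) :
    cauchyDiv l m (C + D) = cauchyDiv l m C + cauchyDiv l m D := by
  ext i α; simp [cauchyDiv, add_div]

lemma cauchyDiv_smul (c : ℂ) (C : Matrix N N ℂ) :
    cauchyDiv l m (c • C) = c • cauchyDiv l m C := by
  ext i α; simp [cauchyDiv, mul_div_assoc]

lemma flowGram_add : flowGram l m H K (A + B) = flowGram l m H K A + flowGram l m H K B := by
  rw [flowGram, flowH_add, flowK_add, flowGram, flowGram, ← cauchyDiv_add]
  congr 1; rw [Matrix.mul_add, Matrix.add_mul]; abel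

lemma flowGram_smul (c : ℂ) : flowGram l m H K (c • A) = c • flowGram l m H K A := by
  rw [flowGram, flowH_smul, flowK_smul, flowGram, ← cauchyDiv_smul]
  congr 1; rw [Matrix.mul_smul, Matrix.smul_mul, smul_add]

lemma flowX_add : flowX l m H K (A + B) = flowX l m H K A + flowX l m H K B := by
  simp only [flowX, flowGram_add, flowH_add, Matrix.add_mul, Matrix.mul_add]; abel

lemma flowX_smul (c : ℂ) : flowX l m H K (c • A) = c • flowX l m H K A := by
  simp only [flowX, flowGram_smul, flowH_smul, Matrix.smul_mul, Matrix.mul_smul, smul_sub]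

lemma flowOne_add : flowOne l m H K (A + B) = flowOne l m H K A + flowOne l m H K B := by
  simp only [flowOne, flowX_add, flowK_add, Matrix.add_mul, Matrix.mul_add]; abel

lemma IsDressing.add (h : IsDressing l m H K A W) (h' : IsDressing l m H K B W') :
    IsDressing l m H K (A + B) (W + W') := by
  intro z hz
  have e := h z hz
  have e' := h' z hz
  simp only [flowS, flowX_add, flowK_add, Matrix.add_mul, Matrix.mul_add, Pi.add_apply] at e e' ⊢
  rw [← e, ← e']; abel

lemma IsDressing.smul (c : ℂ) (h : IsDressing l m H K A W) :
    IsDressing l m H K (c • A) (c • W) := by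
  intro z hz
  have e := h z hz
  simp only [flowS, flowX_smul, flowK_smul, Matrix.smul_mul, Matrix.mul_smul, Pi.smul_apply] at e ⊢
  rw [← e, smul_add, smul_sub, smul_neg]

section Shift

lemma flowH_shift : flowH l H (fun z => z • A z) = flowH l H A * Matrix.diagonal l := by
  ext i α; simp [flowH, mul_comm]

lemma flowK_shift : flowK m K (fun z => z • A z) = Matrix.diagonal m * flowK m K A := by
  ext i α; simp [flowK]

/-- Entrywise this is `m a + l b = l (a + b) - (l - m) a`, divided by `l - m`. -/
lemma flowGram_shift (hlm : ∀ α β, l β - m α ≠ 0) :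
    flowGram l m H K (fun z => z • A z) =
      flowGram l m H K A * Matrix.diagonal l - flowK m K A * H := by
  ext α β
  have h := hlm α β
  simp only [flowGram, flowH_shift, flowK_shift, cauchyDiv, Matrix.sub_apply, Matrix.of_apply,
    Matrix.add_apply, Matrix.mul_diagonal, Matrix.mul_assoc (Matrix.diagonal m),
    Matrix.diagonal_mul, ← Matrix.mul_assoc K]
  field_simp
  ring

lemma flowH_const (C : Matrix (Fin 2) (Fin 2) ℂ) : flowH l H (fun _ => C) = C * H := rfl

lemma flowK_const (C : Matrix (Fin 2) (Fin 2) ℂ) : flowK m K (fun _ => C) = -(K * C) := rfl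

lemma flowGram_const (C : Matrix (Fin 2) (Fin 2) ℂ) : flowGram l m H K (fun _ => C) = 0 := by
  rw [flowGram, flowH_const, flowK_const, Matrix.neg_mul, Matrix.mul_assoc, neg_add_cancel]
  ext; simp [cauchyDiv]

lemma flowX_const (C : Matrix (Fin 2) (Fin 2) ℂ) :
    flowX l m H K (fun _ => C) = C * dressX l m H K := by
  simp [flowX, flowGram_const, flowH_const, dressX, Matrix.mul_assoc]

lemma IsDressing.const (C : Matrix (Fin 2) (Fin 2) ℂ) :
    IsDressing l m H K (fun _ => C) (fun _ => C) := by
  intro z hz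
  simp only [flowS, flowX_const, flowK_const, dressS, Matrix.mul_neg, Matrix.sub_mul,
    Matrix.mul_sub, Matrix.one_mul, Matrix.mul_one, Matrix.mul_assoc]
  abel

variable (hlm : ∀ α β, l β - m α ≠ 0) (hΓ : IsUnit (gram l m H K).det)
include hlm

lemma gram_sylvester : gram l m H K * Matrix.diagonal l =
    Matrix.diagonal m * gram l m H K + K * H := by
  ext α β
  have h := hlm α β
  simp only [gram, cauchyDiv, Matrix.of_apply, Matrix.mul_diagonal, Matrix.add_apply,
    Matrix.diagonal_mul]
  field_simp
  ring

include hΓ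

/-- The Sylvester equation multiplied by `Γ⁻¹` on both sides. It moves the spectral matrix past
`Γ⁻¹`, trading `l` for `m`. -/
lemma diagonal_mul_gram_inv : Matrix.diagonal l * (gram l m H K)⁻¹ =
    (gram l m H K)⁻¹ * (Matrix.diagonal m + K * dressX l m H K) := by
  have h := congrArg (fun Y => (gram l m H K)⁻¹ * Y * (gram l m H K)⁻¹) (gram_sylvester hlm (H := H) (K := K))
  simp only [Matrix.mul_add, Matrix.add_mul] at h
  rw [← Matrix.mul_assoc, Matrix.nonsing_inv_mul _ hΓ, Matrix.one_mul] at h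
  rw [h, Matrix.mul_add, dressX, Matrix.mul_assoc, Matrix.mul_assoc, Matrix.mul_nonsing_inv _ hΓ,
    Matrix.mul_one]
  simp only [Matrix.mul_assoc]

lemma flowX_shift : flowX l m H K (fun z => z • A z) =
    flowX l m H K A * Matrix.diagonal m - flowOne l m H K A * dressX l m H K := by
  have h1 : flowX l m H K (fun z => z • A z) =
      flowX l m H K A * (Matrix.diagonal m + K * dressX l m H K) +
        dressX l m H K * (flowK m K A * dressX l m H K) := by
    simp only [flowX, flowH_shift, flowGram_shift hlm, Matrix.mul_assoc, Matrix.sub_mul,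
      diagonal_mul_gram_inv hlm hΓ, Matrix.mul_sub]
    conv_rhs => rw [dressX]
    simp only [dressX, Matrix.mul_assoc]
    abel
  rw [h1, flowOne]
  simp only [Matrix.mul_add, Matrix.sub_mul, Matrix.neg_mul, Matrix.mul_assoc]
  abel

/-- The engine of the dressing. In the variation for `z A` every `diag(m)` stands next to the
resolvent, where it may be replaced by `z` at the cost of a term without resolvent. The `z` parts
reproduce the relation for `A`; the remainders combine to `-S₁' S`. -/
lemma IsDressing.shift (h : IsDressing l m H K A W) :
    IsDressing l m H K (fun z => z • A z) (fun z => z • W z - flowOne l m H K A) := by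
  intro z hz
  have e := h z hz
  have hD : Matrix.diagonal m * resolv m z = z • resolv m z - 1 := by
    rw [resolv, Matrix.diagonal_mul_diagonal, ← Matrix.diagonal_smul, ← Matrix.diagonal_one,
      Matrix.diagonal_sub]
    congr 1; ext α
    have := hz α
    simp only [Pi.smul_apply, smul_eq_mul]
    field_simp; ring
  have hD' : resolv m z * Matrix.diagonal m = z • resolv m z - 1 := by
    rw [← hD, resolv, Matrix.diagonal_mul_diagonal, Matrix.diagonal_mul_diagonal]
    simp only [mul_comm]
  simp only [Matrix.sub_mul, Matrix.smul_mul, ← e]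
  simp only [flowS, flowX_shift hlm hΓ, flowK_shift, Matrix.sub_mul, dressS, Matrix.mul_sub,
      Matrix.mul_assoc]
  rw [← Matrix.mul_assoc (Matrix.diagonal m), hD, ← Matrix.mul_assoc (resolv m z), hD']
  simp only [flowOne, Matrix.sub_mul, Matrix.mul_sub, Matrix.smul_mul, Matrix.mul_smul,
      Matrix.one_mul,
    Matrix.mul_one, Matrix.neg_mul, smul_add, smul_sub, smul_neg, Matrix.mul_assoc]
  abel

/-- The middle factor `K H` of the product is `(z - m) Γ - Γ (z - l)` by the Sylvester equation, so
each half cancels one resolvent and the cross terms telescope. -/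
lemma dressS_mul_inverse (z : ℂ) (hm : ∀ α, z - m α ≠ 0) (hl : ∀ α, z - l α ≠ 0) :
    dressS l m H K z * (1 + H * (resolv l z * ((gram l m H K)⁻¹ * K))) = 1 := by
  have hD : resolv m z * (Matrix.scalar N z - Matrix.diagonal m) = 1 := by
    rw [resolv, Matrix.scalar_apply, Matrix.diagonal_sub, Matrix.diagonal_mul_diagonal,
        ← Matrix.diagonal_one]
    congr 1; ext α; exact inv_mul_cancel₀ (hm α)
  have hE : (Matrix.scalar N z - Matrix.diagonal l) * resolv l z = 1 := by
    rw [resolv, Matrix.scalar_apply, Matrix.diagonal_sub, Matrix.diagonal_mul_diagonal,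
        ← Matrix.diagonal_one]
    congr 1; ext α; exact mul_inv_cancel₀ (hl α)
  have hKH : K * H = (Matrix.scalar N z - Matrix.diagonal m) * gram l m H K -
      gram l m H K * (Matrix.scalar N z - Matrix.diagonal l) := by
    have := gram_sylvester hlm (H := H) (K := K)
    rw [Matrix.mul_sub, this, Matrix.sub_mul,
        (Matrix.scalar_commute z (fun _ => mul_comm _ _) (gram l m H K)).eq]
    abel
  have key : resolv m z * (K * (H * (resolv l z * ((gram l m H K)⁻¹ * K)))) =
      gram l m H K * (resolv l z * ((gram l m H K)⁻¹ * K)) - resolv m z * K := by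
    rw [← Matrix.mul_assoc K, hKH]
    simp only [Matrix.sub_mul, Matrix.mul_sub, Matrix.mul_assoc] at hD hE ⊢
    have e1 (Y : Matrix N (Fin 2) ℂ) : resolv m z * (Matrix.scalar N z * Y) -
        resolv m z * (Matrix.diagonal m * Y) = Y := by
      rw [← Matrix.mul_assoc, ← Matrix.mul_assoc, ← Matrix.sub_mul, hD, Matrix.one_mul]
    have e2 (Y : Matrix N (Fin 2) ℂ) : Matrix.scalar N z * (resolv l z * Y) -
        Matrix.diagonal l * (resolv l z * Y) = Y := by
      rw [← Matrix.mul_assoc, ← Matrix.mul_assoc, ← Matrix.sub_mul, hE, Matrix.one_mul]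
    rw [e1, ← Matrix.mul_sub (resolv m z), ← Matrix.mul_sub (gram l m H K), e2,
      ← Matrix.mul_assoc (gram l m H K) (gram l m H K)⁻¹, Matrix.mul_nonsing_inv _ hΓ,
          Matrix.one_mul]
  have hX : dressX l m H K * (gram l m H K * (resolv l z * ((gram l m H K)⁻¹ * K))) =
      H * (resolv l z * ((gram l m H K)⁻¹ * K)) := by
    rw [dressX, Matrix.mul_assoc, ← Matrix.mul_assoc (gram l m H K)⁻¹,
        Matrix.nonsing_inv_mul _ hΓ, Matrix.one_mul]
  simp only [dressS, Matrix.mul_add, Matrix.sub_mul, Matrix.one_mul, Matrix.mul_one,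
      Matrix.mul_assoc, key,
    Matrix.mul_sub, hX]
  abel

end Shift

end Dressing

/-! ### Entrywise calculus for matrix functions -/

section MatDeriv

variable {a b c : Type*} [Fintype b]

/-- Entrywise differentiability of a matrix function of a real variable. -/
def HasMatDerivAt (f : ℝ → Matrix a c ℂ) (f' : Matrix a c ℂ) (s : ℝ) : Prop :=
  ∀ i j, HasDerivAt (fun u => f u i j) (f' i j) s

lemma HasMatDerivAt.const (C : Matrix a c ℂ) (s : ℝ) : HasMatDerivAt (fun _ => C) 0 s :=
  fun i j => hasDerivAt_const s (C i j)

lemma HasMatDerivAt.mul {f : ℝ → Matrix a b ℂ} {f' : Matrix a b ℂ} {g : ℝ → Matrix b c ℂ}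
    {g' : Matrix b c ℂ} {s : ℝ} (hf : HasMatDerivAt f f' s) (hg : HasMatDerivAt g g' s) :
    HasMatDerivAt (fun u => f u * g u) (f' * g s + f s * g') s := by
  intro i j
  simp only [Matrix.mul_apply, Matrix.add_apply, ← Finset.sum_add_distrib]
  exact HasDerivAt.fun_sum fun k _ => (hf i k).mul (hg k j)

lemma HasMatDerivAt.sub {f g : ℝ → Matrix a c ℂ} {f' g' : Matrix a c ℂ} {s : ℝ}
    (hf : HasMatDerivAt f f' s) (hg : HasMatDerivAt g g' s) :
    HasMatDerivAt (fun u => f u - g u) (f' - g') s :=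
  fun i j => (hf i j).sub (hg i j)

lemma HasMatDerivAt.neg {f : ℝ → Matrix a c ℂ} {f' : Matrix a c ℂ} {s : ℝ}
    (hf : HasMatDerivAt f f' s) : HasMatDerivAt (fun u => -f u) (-f') s :=
  fun i j => (hf i j).neg

lemma HasMatDerivAt.const_smul {f : ℝ → Matrix a c ℂ} {f' : Matrix a c ℂ} {s : ℝ}
    (hf : HasMatDerivAt f f' s) (r : ℂ) : HasMatDerivAt (fun u => r • f u) (r • f') s :=
  fun i j => (hf i j).const_mul r

lemma HasMatDerivAt.unique {f : ℝ → Matrix a c ℂ} {f' f'' : Matrix a c ℂ} {s : ℝ}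
    (hf : HasMatDerivAt f f' s) (hg : HasMatDerivAt f f'' s) : f' = f'' := by
  ext i j; exact (hf i j).unique (hg i j)

lemma HasMatDerivAt.congr_of_eventuallyEq {f g : ℝ → Matrix a c ℂ} {f' : Matrix a c ℂ} {s : ℝ}
    (hf : HasMatDerivAt f f' s) (h : ∀ᶠ u in nhds s, g u = f u) : HasMatDerivAt g f' s :=
  fun i j => (hf i j).congr_of_eventuallyEq (h.mono fun u hu => by simp [hu])

/-! ### Smoothness of determinants and inverses -/

variable [DecidableEq b]

lemma contDiff_det_entries : ContDiff ℝ (⊤ : WithTop ℕ∞) (fun A : b → b → ℂ => (Matrix.of A).det) := by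
  simp only [Matrix.det_apply]
  refine ContDiff.sum fun σ _ => ContDiff.const_smul _ (contDiff_prod fun i _ => ?_)
  simp only [Matrix.of_apply]
  fun_prop

/-- Cramer's rule: each adjugate entry is the determinant of a matrix with one row replaced by a
constant, hence polynomial in the entries. -/
lemma contDiffAt_inv_entry (i j : b) (A : b → b → ℂ) (hA : (Matrix.of A).det ≠ 0) :
    ContDiffAt ℝ (⊤ : WithTop ℕ∞) (fun A : b → b → ℂ => (Matrix.of A)⁻¹ i j) A := by
  simp only [Matrix.inv_def, Matrix.smul_apply, Ring.inverse_eq_inv', smul_eq_mul,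
    Matrix.adjugate_apply]
  refine ContDiffAt.mul (contDiff_det_entries.contDiffAt.inv hA) (ContDiff.contDiffAt ?_)
  refine contDiff_det_entries.comp
    (g := fun A : b → b → ℂ => (Matrix.of A).det)
    (f := fun A : b → b → ℂ => fun k l => (Matrix.of A).updateRow j (Pi.single i 1) k l) ?_
  rw [contDiff_pi]; intro k
  rw [contDiff_pi]; intro l
  by_cases h : k = j
  · simp only [h, Matrix.updateRow_self]; exact contDiff_const
  · simp only [Matrix.updateRow_ne h, Matrix.of_apply]; fun_prop

lemma contDiffOn_inv_entry {E : Type*} [NormedAddCommGroup E] [NormedSpace ℝ E] {k : WithTop ℕ∞}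
    {f : E → Matrix b b ℂ} {S : Set E} (hf : ∀ i j, ContDiffOn ℝ k (fun p => f p i j) S)
    (hS : ∀ p ∈ S, (f p).det ≠ 0) (i j : b) : ContDiffOn ℝ k (fun p => (f p)⁻¹ i j) S := by
  intro p hp
  have h1 : ContDiffWithinAt ℝ k (fun p => fun i j => f p i j) S p := by
    rw [contDiffWithinAt_pi]; intro i
    rw [contDiffWithinAt_pi]; intro j
    exact hf i j p hp
  exact ((contDiffAt_inv_entry i j (fun i j => f p i j) (hS p hp)).of_le le_top).comp_contDiffWithinAt p h1

lemma contDiffOn_det {E : Type*} [NormedAddCommGroup E] [NormedSpace ℝ E] {k : WithTop ℕ∞}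
    {f : E → Matrix b b ℂ} {S : Set E} (hf : ∀ i j, ContDiffOn ℝ k (fun p => f p i j) S) :
    ContDiffOn ℝ k (fun p => (f p).det) S := by
  have h1 : ContDiffOn ℝ k (fun p => fun i j => f p i j) S := by
    rw [contDiffOn_pi]; intro i
    rw [contDiffOn_pi]; intro j
    exact hf i j
  exact (contDiff_det_entries.of_le le_top).comp_contDiffOn h1

lemma HasMatDerivAt.inv {f : ℝ → Matrix b b ℂ} {f' : Matrix b b ℂ} {s : ℝ}
    (hf : HasMatDerivAt f f' s) (hs : (f s).det ≠ 0) :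
    HasMatDerivAt (fun u => (f u)⁻¹) (-((f s)⁻¹ * (f' * (f s)⁻¹))) s := by
  have hd : DifferentiableAt ℝ (fun u => fun i j => f u i j) s := by
    rw [differentiableAt_pi]; intro i
    rw [differentiableAt_pi]; intro j
    exact (hf i j).differentiableAt
  have hg : HasMatDerivAt (fun u => (f u)⁻¹) (Matrix.of fun i j => deriv (fun u => (f u)⁻¹ i j) s) s := by
    intro i j
    refine DifferentiableAt.hasDerivAt ?_
    exact (((contDiffAt_inv_entry i j (fun i j => f s i j) hs).differentiableAt (by simp)).comp s hd)
  set g' : Matrix b b ℂ := Matrix.of fun i j => deriv (fun u => (f u)⁻¹ i j) s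
  have hdet : DifferentiableAt ℝ (fun u => (f u).det) s :=
    ((contDiff_det_entries (b := b)).differentiable (by simp)).differentiableAt.comp s hd
  have hev : ∀ᶠ u in nhds s, (1 : Matrix b b ℂ) = (f u)⁻¹ * f u := by
    filter_upwards [hdet.continuousAt.eventually_ne hs] with u hu
    exact (Matrix.nonsing_inv_mul _ (isUnit_iff_ne_zero.2 hu)).symm
  -- Differentiability of the inverse is already known, so differentiating `f⁻¹ f = 1` determines
  -- its derivative.
  have h0 := (HasMatDerivAt.const (1 : Matrix b b ℂ) s).unique ((hg.mul hf).congr_of_eventuallyEq hev)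
  have h1 : g' = -((f s)⁻¹ * (f' * (f s)⁻¹)) := by
    have := congrArg (fun Y => Y * (f s)⁻¹) h0
    simp only [Matrix.zero_mul, Matrix.add_mul, Matrix.mul_assoc,
      Matrix.mul_nonsing_inv _ (isUnit_iff_ne_zero.2 hs), Matrix.mul_one] at this
    exact eq_neg_of_add_eq_zero_left this.symm
  rwa [h1] at hg

end MatDeriv

/-! ### Formal variations as actual derivatives along a flow -/

section DressingDeriv

variable {N : Type*} [Fintype N] [DecidableEq N] {l m : N → ℂ} {H : ℝ → Matrix (Fin 2) N ℂ}
  {K : ℝ → Matrix N (Fin 2) ℂ} {A : ℂ → Matrix (Fin 2) (Fin 2) ℂ} {s : ℝ}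
  (hH : HasMatDerivAt H (flowH l (H s) A) s) (hK : HasMatDerivAt K (flowK m (K s) A) s)
include hH hK

lemma hasMatDerivAt_gram :
    HasMatDerivAt (fun u => gram l m (H u) (K u)) (flowGram l m (H s) (K s) A) s := by
  intro α β
  exact (hK.mul hH α β).div_const _

variable (hs : (gram l m (H s) (K s)).det ≠ 0)
include hs

lemma hasMatDerivAt_dressX :
    HasMatDerivAt (fun u => dressX l m (H u) (K u)) (flowX l m (H s) (K s) A) s := by
  have h := hH.mul ((hasMatDerivAt_gram hH hK).inv hs)
  rw [Matrix.mul_neg, ← sub_eq_add_neg, ← Matrix.mul_assoc] at h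
  rwa [flowX, dressX]

lemma hasMatDerivAt_dressS (z : ℂ) :
    HasMatDerivAt (fun u => dressS l m (H u) (K u) z) (flowS l m (H s) (K s) A z) s := by
  have h := (HasMatDerivAt.const 1 s).sub ((hasMatDerivAt_dressX hH hK hs).mul
    ((HasMatDerivAt.const (resolv m z) s).mul hK))
  rwa [Matrix.zero_mul, zero_add, zero_sub, neg_add'] at h

lemma hasMatDerivAt_dressOne :
    HasMatDerivAt (fun u => dressOne l m (H u) (K u)) (flowOne l m (H s) (K s) A) s := by
  have h := ((hasMatDerivAt_dressX hH hK hs).mul hK).neg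
  rwa [neg_add'] at h

end DressingDeriv

/-! ### The columns `h_α` and the rows `h_α(-x,t)^† L` as matrices -/

lemma reflect_reflect (p : ℝ × ℝ) : reflect (reflect p) = p := by simp [reflect]

lemma hasDerivAt_dx {f : ℝ × ℝ → ℂ} {p : ℝ × ℝ} (hf : DifferentiableAt ℝ f p) :
    HasDerivAt (fun s => f (s, p.2)) (dx f p) p.1 := by
  have h : DifferentiableAt ℝ (fun s : ℝ => (s, p.2)) p.1 := by fun_prop
  exact (DifferentiableAt.comp (g := f) p.1 hf h).hasDerivAt

lemma hasDerivAt_dt {f : ℝ × ℝ → ℂ} {p : ℝ × ℝ} (hf : DifferentiableAt ℝ f p) :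
    HasDerivAt (fun s => f (p.1, s)) (dt f p) p.2 := by
  have h : DifferentiableAt ℝ (fun s : ℝ => (p.1, s)) p.2 := by fun_prop
  exact (DifferentiableAt.comp (g := f) p.2 hf h).hasDerivAt

lemma hasDerivAt_dx_barConj {f : ℝ × ℝ → ℂ} {p : ℝ × ℝ} (hf : DifferentiableAt ℝ f (reflect p)) :
    HasDerivAt (fun s => barConj f (s, p.2)) (-conj (dx f (reflect p))) p.1 := by
  have h := (hasDerivAt_dx hf).star
  have h' : HasDerivAt (fun s : ℝ => -s) (-1) p.1 := hasDerivAt_neg p.1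
  refine (HasDerivAt.scomp (g₁ := fun s : ℝ => star (f (s, (reflect p).2))) p.1 h h').congr_deriv ?_
  simp

lemma hasDerivAt_dt_barConj {f : ℝ × ℝ → ℂ} {p : ℝ × ℝ} (hf : DifferentiableAt ℝ f (reflect p)) :
    HasDerivAt (fun s => barConj f (p.1, s)) (conj (dt f (reflect p))) p.2 :=
  (hasDerivAt_dt hf).star

lemma contDiff_reflect {k : WithTop ℕ∞} : ContDiff ℝ k reflect := by
  unfold reflect; fun_prop

lemma contDiffOn_barConj {k : WithTop ℕ∞} {f : ℝ × ℝ → ℂ} {Ω : Set (ℝ × ℝ)}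
    (hΩ : ∀ p ∈ Ω, reflect p ∈ Ω) (hf : ContDiffOn ℝ k f Ω) : ContDiffOn ℝ k (barConj f) Ω :=
  Complex.conjCLE.contDiff.comp_contDiffOn (hf.comp contDiff_reflect.contDiffOn hΩ)

section Setup

variable {n : ℕ} (ε : ℂ) (μ : Fin n → ℂ) (ξ η : Fin n → ℝ × ℝ → ℂ)

/-- The matrix with columns `h_α`. -/
def matH (p : ℝ × ℝ) : Matrix (Fin 2) (Fin n × Fin 2) ℂ :=
  Matrix.of fun i α => hCol ξ η α p i 0

/-- The matrix with rows `h_α(-x,t)^† L`. -/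
def matK (p : ℝ × ℝ) : Matrix (Fin n × Fin 2) (Fin 2) ℂ :=
  Matrix.of fun α j => (hBarRow ξ η α p * matL ε) 0 j

/-- The poles `-λ_α^*` of the dressing matrix. -/
def pole (α : Fin n × Fin 2) : ℂ := -conj (lam μ α)

lemma matH_zero (p : ℝ × ℝ) (α : Fin n × Fin 2) : matH ξ η p 0 α = xiOf ξ α p := rfl

lemma matH_one (p : ℝ × ℝ) (α : Fin n × Fin 2) : matH ξ η p 1 α = etaOf η α p := rfl

lemma matK_zero (p : ℝ × ℝ) (α : Fin n × Fin 2) :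
    matK ε ξ η p α 0 = barConj (xiOf ξ α) p * ε := by
  simp [matK, hBarRow, hCol, matL, Matrix.mul_apply, barConj]

lemma matK_one (p : ℝ × ℝ) (α : Fin n × Fin 2) :
    matK ε ξ η p α 1 = barConj (etaOf η α) p := by
  simp [matK, hBarRow, hCol, matL, Matrix.mul_apply, barConj]

lemma Gam_eq_gram (p : ℝ × ℝ) :
    Gam ε μ ξ η p = gram (lam μ) (pole μ) (matH ξ η p) (matK ε ξ η p) := by
  ext α β
  simp only [Gam, gram, cauchyDiv, pole, Matrix.of_apply, sub_neg_eq_add, add_comm (conj _)]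
  rfl

lemma one_sub_sum_eq_dressS (p : ℝ × ℝ) (z : ℂ) :
    1 - ∑ α, ∑ β, ((Gam ε μ ξ η p)⁻¹ α β / (z + conj (lam μ β))) •
      (hCol ξ η α p * hBarRow ξ η β p * matL ε) =
    dressS (lam μ) (pole μ) (matH ξ η p) (matK ε ξ η p) z := by
  rw [dressS, dressX, ← Gam_eq_gram]
  congr 1
  have hK (α β : Fin n × Fin 2) (i j : Fin 2) : (hCol ξ η α p * hBarRow ξ η β p * matL ε) i j =
      matH ξ η p i α * matK ε ξ η p β j := by
    rw [Matrix.mul_assoc, Matrix.mul_apply, Fin.sum_univ_one]; rfl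
  ext i j
  simp only [Matrix.sum_apply, Matrix.smul_apply, hK, smul_eq_mul]
  rw [Matrix.mul_assoc, Matrix.mul_apply]
  refine Finset.sum_congr rfl fun α _ => ?_
  rw [Matrix.mul_apply, Finset.mul_sum]
  refine Finset.sum_congr rfl fun β _ => ?_
  rw [resolv, Matrix.diagonal_mul, pole, sub_neg_eq_add, div_eq_mul_inv]
  ring

lemma matF_eq_dressS (p : ℝ × ℝ) : matF ε μ ξ η p =
    dressS (lam μ) (pole μ) (matH ξ η p) (matK ε ξ η p) 0 := by
  rw [← one_sub_sum_eq_dressS, matF]; simp only [zero_add]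

lemma matG_eq (z : ℂ) (p : ℝ × ℝ) : matG ε μ ξ η z p = (∏ γ, (z - pole μ γ)) •
    ((matF ε μ ξ η p)⁻¹ * dressS (lam μ) (pole μ) (matH ξ η p) (matK ε ξ η p) z) := by
  rw [← one_sub_sum_eq_dressS, matG]; simp only [pole, sub_neg_eq_add]

/-- The explicit sums are entries of `F = S(0)` and of `S₁`. In this form `newPotential` is the
upper right entry of the gauge-transformed potential matrix. -/
lemma newPotential_eq (q : ℝ × ℝ → ℂ) (p : ℝ × ℝ) : newPotential ε μ ξ η q p =
    matF ε μ ξ η p 1 1 / matF ε μ ξ η p 0 0 *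
      (q p - 2 * dressOne (lam μ) (pole μ) (matH ξ η p) (matK ε ξ η p) 0 1) := by
  have hF (i : Fin 2) : matF ε μ ξ η p i i = 1 - ∑ α, ∑ β, (Gam ε μ ξ η p)⁻¹ α β * matH ξ η p i α *
      matK ε ξ η p β i / conj (lam μ β) := by
    rw [matF, Matrix.sub_apply, Matrix.one_apply_eq]
    simp only [Matrix.sum_apply, Matrix.smul_apply, smul_eq_mul]
    congr 1
    refine Finset.sum_congr rfl fun α _ => Finset.sum_congr rfl fun β _ => ?_
    rw [Matrix.mul_assoc, Matrix.mul_apply, Fin.sum_univ_one]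
    change _ * (matH ξ η p i α * matK ε ξ η p β i) = _
    ring
  have h1 : dressOne (lam μ) (pole μ) (matH ξ η p) (matK ε ξ η p) 0 1 =
      -∑ α, ∑ β, (Gam ε μ ξ η p)⁻¹ α β * matH ξ η p 0 α * matK ε ξ η p β 1 := by
    rw [dressOne, dressX, ← Gam_eq_gram, Matrix.neg_apply, Matrix.mul_assoc, Matrix.mul_apply]
    congr 1
    refine Finset.sum_congr rfl fun α _ => ?_
    rw [Matrix.mul_apply, Finset.mul_sum]
    refine Finset.sum_congr rfl fun β _ => ?_
    ring
  rw [newPotential, hF, hF, h1]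
  simp only [matH_zero, matH_one, matK_zero, matK_one]
  congr 1
  · congr 2
    rw [Finset.mul_sum]
    refine Finset.sum_congr rfl fun α _ => ?_
    rw [Finset.mul_sum]
    refine Finset.sum_congr rfl fun β _ => ?_
    ring
  · ring

/-! ### Parity -/

/-- The exchange of the indices `2j-1` and `2j`. -/
def swapIdx : Fin n × Fin 2 ≃ Fin n × Fin 2 := Equiv.prodCongr (Equiv.refl _) (Equiv.swap 0 1)

lemma lam_swapIdx (α : Fin n × Fin 2) : lam μ (swapIdx α) = -lam μ α := by
  obtain ⟨j, i⟩ := α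
  fin_cases i <;> simp [swapIdx, lam]

lemma xiOf_swapIdx (α : Fin n × Fin 2) : xiOf ξ (swapIdx α) = xiOf ξ α := rfl

lemma etaOf_swapIdx (α : Fin n × Fin 2) (p : ℝ × ℝ) :
    etaOf η (swapIdx α) p = -etaOf η α p := by
  obtain ⟨j, i⟩ := α
  fin_cases i <;> simp [swapIdx, etaOf]

lemma matH_swapIdx (p : ℝ × ℝ) (i : Fin 2) (α : Fin n × Fin 2) :
    matH ξ η p i (swapIdx α) = (-1) ^ (i : ℕ) * matH ξ η p i α := by
  fin_cases i
  · simp [matH_zero, xiOf_swapIdx]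
  · simp [matH_one, etaOf_swapIdx]

lemma matK_swapIdx (p : ℝ × ℝ) (i : Fin 2) (α : Fin n × Fin 2) :
    matK ε ξ η p (swapIdx α) i = (-1) ^ (i : ℕ) * matK ε ξ η p α i := by
  fin_cases i
  · simp [matK_zero, xiOf_swapIdx]
  · simp [matK_one, etaOf_swapIdx, barConj]

lemma pole_swapIdx (α : Fin n × Fin 2) : pole μ (swapIdx α) = -pole μ α := by
  simp [pole, lam_swapIdx]

/-- The swap sends `λ` to `-λ` and `h` to `σ₃ h`. Numerators are unchanged since `L` is diagonal;
denominators change sign. -/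
lemma Gam_swapIdx (p : ℝ × ℝ) :
    (Gam ε μ ξ η p).submatrix swapIdx swapIdx = -Gam ε μ ξ η p := by
  ext α β
  rw [Gam_eq_gram, Matrix.submatrix_apply, Matrix.neg_apply]
  simp only [gram, cauchyDiv, Matrix.of_apply, Matrix.mul_apply, matH_swapIdx, matK_swapIdx,
    pole_swapIdx, lam_swapIdx, Fin.sum_univ_two]
  rw [← div_neg]
  congr 1
  · simp
  · ring

lemma Gam_inv_swapIdx (p : ℝ × ℝ) (α β : Fin n × Fin 2) :
    (Gam ε μ ξ η p)⁻¹ (swapIdx α) (swapIdx β) = -(Gam ε μ ξ η p)⁻¹ α β := by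
  have h := Matrix.inv_submatrix_equiv (Gam ε μ ξ η p) swapIdx swapIdx
  rw [Gam_swapIdx] at h
  have h' : (-Gam ε μ ξ η p)⁻¹ = -(Gam ε μ ξ η p)⁻¹ := by
    -- The relation also holds at singular `Γ`, where both inverses are zero by convention.
    by_cases hu : IsUnit (Gam ε μ ξ η p).det
    · refine Matrix.inv_eq_left_inv ?_
      rw [neg_mul_neg, Matrix.nonsing_inv_mul _ hu]
    · rw [Matrix.nonsing_inv_apply_not_isUnit _ hu, neg_zero, Matrix.nonsing_inv_apply_not_isUnit]
      rw [Matrix.det_neg]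
      exact fun h => hu (isUnit_of_mul_isUnit_right h)
  rw [h'] at h
  exact (congrFun (congrFun h α) β).symm

lemma dressX_mul_apply (p : ℝ × ℝ) (w : Fin n × Fin 2 → ℂ) (i j : Fin 2) :
    (dressX (lam μ) (pole μ) (matH ξ η p) (matK ε ξ η p) * (Matrix.diagonal w * matK ε ξ η p)) i j =
    ∑ α, ∑ β, matH ξ η p i α * ((Gam ε μ ξ η p)⁻¹ α β * (w β * matK ε ξ η p β j)) := by
  rw [dressX, Matrix.mul_assoc, ← Gam_eq_gram, Matrix.mul_apply]
  refine Finset.sum_congr rfl fun α _ => ?_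
  rw [Matrix.mul_apply, Finset.mul_sum]
  refine Finset.sum_congr rfl fun β _ => ?_
  rw [Matrix.diagonal_mul]

/-- Reindexing both sums by the swap multiplies the entry by `-c (-1)^(i+j)`. For odd weights (`c =
-1`) off-diagonal entries vanish, as needed for `F`; for even weights (`c = 1`) diagonal entries
vanish, as needed for `S₁`. -/
lemma sum_parity (p : ℝ × ℝ) (w : Fin n × Fin 2 → ℂ) (c : ℂ) (hw : ∀ α, w (swapIdx α) = c * w α)
    (i j : Fin 2) :
    (dressX (lam μ) (pole μ) (matH ξ η p) (matK ε ξ η p) * (Matrix.diagonal w * matK ε ξ η p)) i j =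
    -c * (-1) ^ (i + j : ℕ) *
    (dressX (lam μ) (pole μ) (matH ξ η p) (matK ε ξ η p) * (Matrix.diagonal w * matK ε ξ η p)) i j := by
  rw [dressX_mul_apply]
  conv_lhs => rw [← Equiv.sum_comp swapIdx]
  rw [Finset.mul_sum]
  refine Finset.sum_congr rfl fun α _ => ?_
  conv_lhs => rw [← Equiv.sum_comp swapIdx]
  rw [Finset.mul_sum]
  refine Finset.sum_congr rfl fun β _ => ?_
  rw [matH_swapIdx, matK_swapIdx, Gam_inv_swapIdx, hw, pow_add]
  ring

lemma matF_isDiag (p : ℝ × ℝ) : (matF ε μ ξ η p).IsDiag := by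
  have hw : ∀ α : Fin n × Fin 2, (0 - pole μ (swapIdx α))⁻¹ = -1 * (0 - pole μ α)⁻¹ := by
    intro α; rw [pole_swapIdx, zero_sub, zero_sub, inv_neg, neg_one_mul]
  have h := sum_parity ε μ ξ η p (fun α => (0 - pole μ α)⁻¹) (-1) hw
  intro i j hij
  rw [matF_eq_dressS, dressS, Matrix.sub_apply, Matrix.one_apply_ne hij, resolv, zero_sub,
      neg_eq_zero]
  have h' := h i j
  fin_cases i <;> fin_cases j <;> simp at hij h' ⊢ <;> exact self_eq_neg.1 h'

lemma dressOne_diag (p : ℝ × ℝ) (i : Fin 2) :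
    dressOne (lam μ) (pole μ) (matH ξ η p) (matK ε ξ η p) i i = 0 := by
  have h := sum_parity ε μ ξ η p (fun _ => 1) 1 (by simp) i i
  rw [Matrix.diagonal_one, Matrix.one_mul] at h
  rw [dressOne, Matrix.neg_apply, neg_eq_zero]
  rw [← two_mul, pow_mul] at h
  simpa [self_eq_neg] using h

end Setup

/-! ### Partial derivatives and regularity -/

lemma dx_eq_fderiv {f : ℝ × ℝ → ℂ} {p : ℝ × ℝ} (hf : DifferentiableAt ℝ f p) :
    dx f p = fderiv ℝ f p (1, 0) := by
  have h : HasDerivAt (fun s : ℝ => (s, p.2)) ((1 : ℝ), (0 : ℝ)) p.1 :=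
    (hasDerivAt_id _).prodMk (hasDerivAt_const _ _)
  exact (HasFDerivAt.comp_hasDerivAt (l := f) p.1 hf.hasFDerivAt h).deriv

lemma dt_eq_fderiv {f : ℝ × ℝ → ℂ} {p : ℝ × ℝ} (hf : DifferentiableAt ℝ f p) :
    dt f p = fderiv ℝ f p (0, 1) := by
  have h : HasDerivAt (fun s : ℝ => (p.1, s)) ((0 : ℝ), (1 : ℝ)) p.2 :=
    (hasDerivAt_const _ _).prodMk (hasDerivAt_id _)
  exact (HasFDerivAt.comp_hasDerivAt (l := f) p.2 hf.hasFDerivAt h).deriv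

lemma contDiffOn_dx {f : ℝ × ℝ → ℂ} {Ω : Set (ℝ × ℝ)} (hΩ : IsOpen Ω) {m k : WithTop ℕ∞}
    (hf : ContDiffOn ℝ k f Ω) (hm : m + 1 ≤ k) : ContDiffOn ℝ m (dx f) Ω := by
  refine ((hf.fderiv_of_isOpen hΩ hm).clm_apply
    (contDiffOn_const (c := ((1 : ℝ), (0 : ℝ))))).congr fun p hp => dx_eq_fderiv ?_
  exact (hf.contDiffAt (hΩ.mem_nhds hp)).differentiableAt
    (ne_of_gt (lt_of_lt_of_le (by simp) hm))

lemma contDiffOn_succ_of_partials {f : ℝ × ℝ → ℂ} {Ω : Set (ℝ × ℝ)} (hΩ : IsOpen Ω) {m : ℕ}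
    (hf : DifferentiableOn ℝ f Ω) (hx : ContDiffOn ℝ m (dx f) Ω) (ht : ContDiffOn ℝ m (dt f) Ω) :
    ContDiffOn ℝ (m + 1) f Ω := by
  rw [contDiffOn_succ_iff_fderiv_of_isOpen hΩ]
  refine ⟨hf, by simp, ?_⟩
  have h : ContDiffOn ℝ m (fun p => (ContinuousLinearMap.fst ℝ ℝ ℝ).smulRight (dx f p) +
      (ContinuousLinearMap.snd ℝ ℝ ℝ).smulRight (dt f p)) Ω :=
    (contDiffOn_const.smulRight hx).add (contDiffOn_const.smulRight ht)
  refine h.congr fun p hp => ?_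
  have hp' := hf.differentiableAt (hΩ.mem_nhds hp)
  ext <;> simp [dx_eq_fderiv hp', dt_eq_fderiv hp']

lemma dx_reduction {ε : ℂ} {q : ℝ × ℝ → ℂ} {p : ℝ × ℝ} (hq : DifferentiableAt ℝ q (reflect p)) :
    dx (reduction ε q) p = ε * conj (dx q (reflect p)) := by
  have h := ((hasDerivAt_dx_barConj hq).const_mul (-ε)).deriv
  rw [neg_mul_neg] at h
  exact h

lemma contDiffOn_reduction {ε : ℂ} {q : ℝ × ℝ → ℂ} {Ω : Set (ℝ × ℝ)} {k : WithTop ℕ∞}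
    (hΩ : ∀ p ∈ Ω, reflect p ∈ Ω) (hq : ContDiffOn ℝ k q Ω) :
    ContDiffOn ℝ k (reduction ε q) Ω :=
  contDiffOn_const.mul (contDiffOn_barConj hΩ hq)

lemma mulVec_fin_two (A : Matrix (Fin 2) (Fin 2) ℂ) (a b : ℂ) :
    A.mulVec ![a, b] = ![A 0 0 * a + A 0 1 * b, A 1 0 * a + A 1 1 * b] := by
  ext i; fin_cases i <;> simp [Matrix.mulVec, Matrix.vecHead, Matrix.vecTail]

/-- Bootstrapping: the Lax equations express the partial derivatives through `ξ`, `η`, `q`, `r`,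
`q_x`, `r_x`. Each round gains one derivative as long as `q_x` and `r_x` are smooth enough, which
stops exactly at `C^k`. -/
lemma IsLaxSolution.contDiffOn {q r ξ η : ℝ × ℝ → ℂ} {z : ℂ} {Ω : Set (ℝ × ℝ)} (hΩ : IsOpen Ω)
    {k : ℕ∞} (hq : ContDiffOn ℝ (k : WithTop ℕ∞) q Ω) (hr : ContDiffOn ℝ (k : WithTop ℕ∞) r Ω)
    (h : IsLaxSolution q r z ξ η Ω) :
    ContDiffOn ℝ (k : WithTop ℕ∞) ξ Ω ∧ ContDiffOn ℝ (k : WithTop ℕ∞) η Ω := by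
  obtain ⟨hξ, hη, heq⟩ := h
  have key : ∀ j : ℕ, (j : ℕ∞) ≤ k → ContDiffOn ℝ j ξ Ω ∧ ContDiffOn ℝ j η Ω := by
    intro j
    induction j with
    | zero =>
      intro _
      exact ⟨contDiffOn_zero.2 hξ.continuousOn, contDiffOn_zero.2 hη.continuousOn⟩
    | succ j ih =>
      intro hj
      have hj' : ((j : WithTop ℕ∞) + 1) ≤ k := by exact_mod_cast hj
      have hjk : (j : WithTop ℕ∞) ≤ k := le_trans (by simp) hj'
      obtain ⟨h1, h2⟩ := ih (by exact_mod_cast hjk)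
      have hq0 := hq.of_le hjk
      have hr0 := hr.of_le hjk
      have hqx := contDiffOn_dx hΩ hq hj'
      have hrx := contDiffOn_dx hΩ hr hj'
      push_cast
      refine ⟨contDiffOn_succ_of_partials hΩ hξ ?_ ?_, contDiffOn_succ_of_partials hΩ hη ?_ ?_⟩
      · refine ContDiffOn.congr (f := fun p => z ^ 2 * ξ p + z * q p * η p) (by fun_prop) ?_
        intro p hp
        have := congrFun ((heq p hp).1.trans (mulVec_fin_two _ _ _)) 0
        simpa [laxU] using this
      · refine ContDiffOn.congr (f := fun p =>
          (-2 * Complex.I * z ^ 4 + Complex.I * q p * r p * z ^ 2) * ξ p +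
          (-2 * Complex.I * q p * z ^ 3 +
            (-Complex.I * dx q p + Complex.I * q p ^ 2 * r p) * z) * η p) (by fun_prop) ?_
        intro p hp
        have := congrFun ((heq p hp).2.trans (mulVec_fin_two _ _ _)) 0
        simpa [laxV] using this
      · refine ContDiffOn.congr (f := fun p => z * r p * ξ p + -z ^ 2 * η p) (by fun_prop) ?_
        intro p hp
        have := congrFun ((heq p hp).1.trans (mulVec_fin_two _ _ _)) 1
        simpa [laxU] using this
      · refine ContDiffOn.congr (f := fun p =>
          (-2 * Complex.I * r p * z ^ 3 +
            (Complex.I * dx r p + Complex.I * q p * r p ^ 2) * z) * ξ p +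
          (2 * Complex.I * z ^ 4 - Complex.I * q p * r p * z ^ 2) * η p) (by fun_prop) ?_
        intro p hp
        have := congrFun ((heq p hp).2.trans (mulVec_fin_two _ _ _)) 1
        simpa [laxV] using this
  constructor
  · rw [contDiffOn_iff_forall_nat_le]
    exact fun j hj => (key j (by exact_mod_cast hj)).1
  · rw [contDiffOn_iff_forall_nat_le]
    exact fun j hj => (key j (by exact_mod_cast hj)).2

section Setup

variable {n : ℕ} {ε : ℂ} {μ : Fin n → ℂ} {ξ η : Fin n → ℝ × ℝ → ℂ}

/-! ### The reflection symmetry -/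

lemma matK_apply (p : ℝ × ℝ) (α : Fin n × Fin 2) (i : Fin 2) :
    matK ε ξ η p α i = matL ε i i * conj (matH ξ η (reflect p) i α) := by
  fin_cases i
  · simp [matK_zero, matL, matH_zero, barConj, mul_comm]
  · simp [matK_one, matL, matH_one, barConj]

lemma conj_eps (hε : ε = 1 ∨ ε = -1) : conj ε = ε := by
  rcases hε with rfl | rfl <;> simp

lemma conj_matL (hε : ε = 1 ∨ ε = -1) (i : Fin 2) : conj (matL ε i i) = matL ε i i := by
  fin_cases i <;> simp [matL, conj_eps hε]

lemma conj_matK_reflect (hε : ε = 1 ∨ ε = -1) (p : ℝ × ℝ) (α : Fin n × Fin 2) (i : Fin 2) :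
    conj (matK ε ξ η (reflect p) α i) = matL ε i i * matH ξ η p i α := by
  rw [matK_apply, reflect_reflect, map_mul, Complex.conj_conj, conj_matL hε]

/-- Reflection and conjugate transposition exchange the roles of `h_α` and `h_β`, and `L` is real.
Hence `det Γ` at a point and at its reflection are conjugate. -/
lemma conjTranspose_Gam_reflect (hε : ε = 1 ∨ ε = -1) (p : ℝ × ℝ) :
    (Gam ε μ ξ η (reflect p)).conjTranspose = Gam ε μ ξ η p := by
  ext α β
  rw [Gam_eq_gram, Gam_eq_gram, Matrix.conjTranspose_apply]
  simp only [gram, cauchyDiv, Matrix.of_apply, Matrix.mul_apply, Fin.sum_univ_two,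
    ← starRingEnd_apply, map_div₀, map_add, map_mul, map_sub, conj_matK_reflect hε, pole, map_neg,
    Complex.conj_conj]
  rw [matK_apply, matK_apply]
  congr 1 <;> ring

lemma conj_Gam_inv_reflect (hε : ε = 1 ∨ ε = -1) (p : ℝ × ℝ) (α β : Fin n × Fin 2) :
    conj ((Gam ε μ ξ η (reflect p))⁻¹ α β) = (Gam ε μ ξ η p)⁻¹ β α := by
  rw [← conjTranspose_Gam_reflect hε p, ← Matrix.conjTranspose_nonsing_inv,
    Matrix.conjTranspose_apply, starRingEnd_apply]

lemma regularSet_reflect (hε : ε = 1 ∨ ε = -1) {Ω : Set (ℝ × ℝ)} (hΩ : ∀ p ∈ Ω, reflect p ∈ Ω)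
    {p : ℝ × ℝ} (hp : p ∈ regularSet ε μ ξ η Ω) : reflect p ∈ regularSet ε μ ξ η Ω := by
  refine ⟨hΩ p hp.1, fun h => hp.2 ?_⟩
  rw [← conjTranspose_Gam_reflect hε p, Matrix.det_conjTranspose, h, star_zero]

/-- The adjoint at the reflected point turns `H Γ⁻¹ w K` into `H w^* Γ⁻¹ K`, up to `L`. The latter
is the form of the sum in the inverse of `S`, so this identifies reflected adjoints with inverses.
-/
lemma conj_dressX_mul_reflect (hε : ε = 1 ∨ ε = -1) (p : ℝ × ℝ) (w : Fin n × Fin 2 → ℂ)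
    (i j : Fin 2) :
    matL ε i i * conj ((dressX (lam μ) (pole μ) (matH ξ η (reflect p)) (matK ε ξ η (reflect p)) *
      (Matrix.diagonal w * matK ε ξ η (reflect p))) i j) =
    matL ε j j * (matH ξ η p * (Matrix.diagonal (fun α => conj (w α)) *
      ((Gam ε μ ξ η p)⁻¹ * matK ε ξ η p))) j i := by
  rw [dressX_mul_apply, Matrix.mul_apply]
  simp only [Matrix.diagonal_mul, Finset.mul_sum, map_sum, map_mul,
    conj_Gam_inv_reflect hε, conj_matK_reflect hε]
  rw [Finset.sum_comm]
  refine Finset.sum_congr rfl fun α _ => ?_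
  rw [Matrix.mul_apply]
  simp only [Finset.mul_sum]
  refine Finset.sum_congr rfl fun β _ => ?_
  rw [matK_apply]
  ring

lemma dressOne_one_zero (hε : ε = 1 ∨ ε = -1) (p : ℝ × ℝ) :
    dressOne (lam μ) (pole μ) (matH ξ η p) (matK ε ξ η p) 1 0 =
      ε * conj (dressOne (lam μ) (pole μ) (matH ξ η (reflect p)) (matK ε ξ η (reflect p)) 0 1) := by
  have h := conj_dressX_mul_reflect (μ := μ) (ξ := ξ) (η := η) hε p (fun _ => 1) 0 1
  simp only [Matrix.diagonal_one, Matrix.one_mul, map_one] at h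
  rw [dressOne, Matrix.neg_apply, dressOne, Matrix.neg_apply, map_neg, mul_neg, neg_inj,
    dressX, Matrix.mul_assoc, ← Gam_eq_gram]
  simpa [matL] using h.symm

lemma matL_ne_zero (hε : ε = 1 ∨ ε = -1) (i : Fin 2) : matL ε i i ≠ 0 := by
  fin_cases i <;> rcases hε with rfl | rfl <;> simp [matL]

variable (hlm : ∀ α β, lam μ β - pole μ α ≠ 0) (hl : ∀ α, lam μ α ≠ 0)
include hlm hl

lemma matF_mul_inverse {p : ℝ × ℝ} (hp : (Gam ε μ ξ η p).det ≠ 0) :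
    matF ε μ ξ η p * (1 + matH ξ η p * (resolv (lam μ) 0 * ((Gam ε μ ξ η p)⁻¹ * matK ε ξ η p))) = 1 := by
  rw [Gam_eq_gram] at hp
  rw [matF_eq_dressS, Gam_eq_gram]
  refine dressS_mul_inverse hlm (isUnit_iff_ne_zero.2 hp) 0 ?_ ?_
  · intro α; simpa [pole] using hl α
  · intro α; simpa using hl α

lemma isUnit_matF {p : ℝ × ℝ} (hp : (Gam ε μ ξ η p).det ≠ 0) : IsUnit (matF ε μ ξ η p) :=
  IsUnit.of_mul_eq_one _ (matF_mul_inverse hlm hl hp)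

/-- The reflected conjugate of `F_ii` is the diagonal entry of the explicit inverse of `F`, and `F`
is diagonal. This makes the prefactors of the two new potentials compatible with the reduction. -/
lemma matF_mul_conj_reflect (hε : ε = 1 ∨ ε = -1) {p : ℝ × ℝ} (hp : (Gam ε μ ξ η p).det ≠ 0)
    (i : Fin 2) : matF ε μ ξ η p i i * conj (matF ε μ ξ η (reflect p) i i) = 1 := by
  have h : conj (matF ε μ ξ η (reflect p) i i) =
      (1 + matH ξ η p * (resolv (lam μ) 0 * ((Gam ε μ ξ η p)⁻¹ * matK ε ξ η p)) :
        Matrix (Fin 2) (Fin 2) ℂ) i i := by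
    have h1 := conj_dressX_mul_reflect (μ := μ) (ξ := ξ) (η := η) hε p (fun α => (0 - pole μ α)⁻¹) i i
    have h2 := mul_left_cancel₀ (matL_ne_zero hε i) h1
    rw [matF_eq_dressS, dressS, Matrix.sub_apply, map_sub, resolv, h2, Matrix.add_apply,
      Matrix.one_apply_eq, map_one, sub_eq_add_neg, ← Matrix.neg_apply, ← Matrix.mul_neg,
      ← Matrix.neg_mul, Matrix.diagonal_neg, resolv]
    congr 6
    simp [pole, inv_neg]
  rw [h]
  have h3 := congrFun (congrFun (matF_mul_inverse hlm hl hp) i) i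
  rw [Matrix.mul_apply, Matrix.one_apply_eq, Fintype.sum_eq_single i] at h3
  · exact h3
  · intro j hj
    rw [matF_isDiag ε μ ξ η p hj.symm, zero_mul]

end Setup

/-! ### The flows of the columns and of the rows -/

section Flow

variable {n : ℕ} {ε : ℂ} {μ : Fin n → ℂ} {ξ η : Fin n → ℝ × ℝ → ℂ} {q : ℝ × ℝ → ℂ}
  {Ω : Set (ℝ × ℝ)}

/-- For the partner index this is the symmetry `σ₃ U(λ) σ₃ = U(-λ)`, and likewise for `V`. -/
lemma isLaxSolution_all {r : ℝ × ℝ → ℂ} (hh : ∀ j, IsLaxSolution q r (μ j) (ξ j) (η j) Ω)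
    (α : Fin n × Fin 2) : IsLaxSolution q r (lam μ α) (xiOf ξ α) (etaOf η α) Ω := by
  obtain ⟨j, i⟩ := α
  fin_cases i
  · exact hh j
  · obtain ⟨h1, h2, h3⟩ := hh j
    refine ⟨h1, h2.neg, fun p hp => ?_⟩
    obtain ⟨ex, et⟩ := h3 p hp
    have ex0 := congrFun ex 0
    have ex1 := congrFun ex 1
    have et0 := congrFun et 0
    have et1 := congrFun et 1
    have hdx : dx (etaOf η (j, 1)) p = -dx (η j) p := deriv.fun_neg
    have hdt : dt (etaOf η (j, 1)) p = -dt (η j) p := deriv.fun_neg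
    simp only [laxU, laxV, Matrix.mulVec, Matrix.of_apply, Matrix.cons_val_zero,
        Matrix.cons_val_one,
      Matrix.vec2_dotProduct] at ex0 ex1 et0 et1
    constructor <;> ext i <;> fin_cases i <;>
      simp [hdx, hdt, laxU, laxV, lam, Matrix.mulVec, xiOf, ex0, ex1, et0, et1] <;>
      simp [etaOf] <;> ring

variable (hΩ : IsOpen Ω) (hΩs : ∀ p ∈ Ω, reflect p ∈ Ω) (hε : ε = 1 ∨ ε = -1)
  (hh : ∀ j, IsLaxSolution q (reduction ε q) (μ j) (ξ j) (η j) Ω)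
  {p : ℝ × ℝ} (hp : p ∈ Ω)

include hΩ hh hp

lemma hasMatDerivAt_matH_x : HasMatDerivAt (fun s => matH ξ η (s, p.2))
    (flowH (lam μ) (matH ξ η p) (fun z => laxU q (reduction ε q) z p)) p.1 := by
  intro i α
  obtain ⟨h1, h2, h3⟩ := isLaxSolution_all hh α
  have e := (h3 p hp).1
  fin_cases i
  · refine (hasDerivAt_dx (h1.differentiableAt (hΩ.mem_nhds hp))).congr_deriv ?_
    exact (congrFun (e.trans (mulVec_fin_two _ _ _)) 0).trans (by simp [flowH, Matrix.mul_apply,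
        matH_zero, matH_one])
  · refine (hasDerivAt_dx (h2.differentiableAt (hΩ.mem_nhds hp))).congr_deriv ?_
    exact (congrFun (e.trans (mulVec_fin_two _ _ _)) 1).trans (by simp [flowH, Matrix.mul_apply,
        matH_zero, matH_one])

lemma hasMatDerivAt_matH_t : HasMatDerivAt (fun s => matH ξ η (p.1, s))
    (flowH (lam μ) (matH ξ η p) (fun z => laxV q (reduction ε q) z p)) p.2 := by
  intro i α
  obtain ⟨h1, h2, h3⟩ := isLaxSolution_all hh α
  have e := (h3 p hp).2
  fin_cases i
  · refine (hasDerivAt_dt (h1.differentiableAt (hΩ.mem_nhds hp))).congr_deriv ?_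
    exact (congrFun (e.trans (mulVec_fin_two _ _ _)) 0).trans (by simp [flowH, Matrix.mul_apply,
        matH_zero, matH_one])
  · refine (hasDerivAt_dt (h2.differentiableAt (hΩ.mem_nhds hp))).congr_deriv ?_
    exact (congrFun (e.trans (mulVec_fin_two _ _ _)) 1).trans (by simp [flowH, Matrix.mul_apply,
        matH_zero, matH_one])

include hΩs hε

/-- The nonlocal reduction amounts to `U(λ)(-x,t)^† L = L U(-λ^*)(x,t)`. The minus sign of the dual
flow comes from differentiating `-x`. -/
lemma hasMatDerivAt_matK_x : HasMatDerivAt (fun s => matK ε ξ η (s, p.2))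
    (flowK (pole μ) (matK ε ξ η p) (fun z => laxU q (reduction ε q) z p)) p.1 := by
  intro α i
  obtain ⟨h1, h2, h3⟩ := isLaxSolution_all hh α
  have hp' := hΩs p hp
  have e := (h3 _ hp').1
  have e0 := congrFun e 0
  have e1 := congrFun e 1
  simp only [laxU, reduction, barConj, reflect_reflect, Matrix.mulVec, Matrix.of_apply,
    Matrix.cons_val_zero, Matrix.cons_val_one, Matrix.vec2_dotProduct] at e0 e1
  fin_cases i
  · simp only [Fin.zero_eta, matK_zero]
    refine ((hasDerivAt_dx_barConj (h1.differentiableAt (hΩ.mem_nhds hp'))).mul_const ε).congr_deriv ?_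
    rw [e0]
    simp [flowK, Matrix.mul_apply, laxU, matK_zero, matK_one, pole, reduction, barConj]
    ring
  · simp only [Fin.mk_one, matK_one]
    refine (hasDerivAt_dx_barConj (h2.differentiableAt (hΩ.mem_nhds hp'))).congr_deriv ?_
    rw [e1]
    simp [flowK, Matrix.mul_apply, laxU, matK_zero, matK_one, pole, reduction, barConj, conj_eps hε]
    ring

variable (hq : DifferentiableOn ℝ q Ω)
include hq

/-- Here `V(λ)(-x,t)^† L = -L V(-λ^*)(x,t)`, so the minus sign of the dual flow comes from `V`
itself. -/
lemma hasMatDerivAt_matK_t : HasMatDerivAt (fun s => matK ε ξ η (p.1, s))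
    (flowK (pole μ) (matK ε ξ η p) (fun z => laxV q (reduction ε q) z p)) p.2 := by
  intro α i
  obtain ⟨h1, h2, h3⟩ := isLaxSolution_all hh α
  have hp' := hΩs p hp
  have e := (h3 _ hp').2
  have e0 := congrFun e 0
  have e1 := congrFun e 1
  have hr := dx_reduction (ε := ε) (p := p) (hq.differentiableAt (hΩ.mem_nhds hp'))
  have hr' := dx_reduction (ε := ε) (p := reflect p) (q := q)
    (by rw [reflect_reflect]; exact hq.differentiableAt (hΩ.mem_nhds hp))
  rw [reflect_reflect] at hr'
  simp only [laxV, hr', Matrix.mulVec, Matrix.of_apply,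
    Matrix.cons_val_zero, Matrix.cons_val_one, Matrix.vec2_dotProduct] at e0 e1
  simp only [reduction, barConj, reflect_reflect] at e0 e1
  fin_cases i
  · simp only [Fin.zero_eta, matK_zero]
    refine ((hasDerivAt_dt_barConj (h1.differentiableAt (hΩ.mem_nhds hp'))).mul_const ε).congr_deriv ?_
    rw [e0]
    simp [flowK, Matrix.mul_apply, laxV, hr, matK_zero, matK_one, pole, conj_eps hε, map_ofNat]
    simp only [reduction, barConj]
    ring
  · simp only [Fin.mk_one, matK_one]
    refine (hasDerivAt_dt_barConj (h2.differentiableAt (hΩ.mem_nhds hp'))).congr_deriv ?_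
    rw [e1]
    simp [flowK, Matrix.mul_apply, laxV, hr, matK_zero, matK_one, pole, conj_eps hε, map_ofNat]
    simp only [reduction, barConj]
    ring

end Flow

/-! ### The dressed Lax pair -/

/-- The third Pauli matrix. -/
def sigma3 : Matrix (Fin 2) (Fin 2) ℂ := !![1, 0; 0, -1]

/-- The off-diagonal matrix with entries `a`, `b`. -/
def offDiag (a b : ℂ) : Matrix (Fin 2) (Fin 2) ℂ := !![0, a; b, 0]

lemma laxU_eq (q r : ℝ × ℝ → ℂ) (z : ℂ) (p : ℝ × ℝ) :
    laxU q r z p = z • (z • sigma3 + offDiag (q p) (r p)) := by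
  ext i j; fin_cases i <;> fin_cases j <;> simp [laxU, sigma3, offDiag] <;> ring

/-- The coefficient of `λ` in the matrix `V`. -/
def laxVOne (q r : ℝ × ℝ → ℂ) (p : ℝ × ℝ) : Matrix (Fin 2) (Fin 2) ℂ :=
  offDiag (-Complex.I * dx q p + Complex.I * q p ^ 2 * r p)
    (Complex.I * dx r p + Complex.I * q p * r p ^ 2)

/-- Writes `V` as obtained from constants and `U` by sums, multiples and multiplication by `z`, the
operations under which dressing is stable. -/
lemma laxV_eq (q r : ℝ × ℝ → ℂ) (z : ℂ) (p : ℝ × ℝ) :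
    laxV q r z p = z • ((-2 * Complex.I) • (z • laxU q r z p) +
      (Complex.I * q p * r p) • (z • sigma3) + laxVOne q r p) := by
  ext i j; fin_cases i <;> fin_cases j <;> simp [laxV, laxU, sigma3, offDiag, laxVOne] <;> ring

section DressedPair

variable {N : Type*} [Fintype N] [DecidableEq N] (l m : N → ℂ) (H : Matrix (Fin 2) N ℂ)
  (K : Matrix N (Fin 2) ℂ)

/-- The commutator of the `z⁻¹` coefficient of the dressing matrix with `σ₃`. -/
def dressComm : Matrix (Fin 2) (Fin 2) ℂ :=
  dressOne l m H K * sigma3 - sigma3 * dressOne l m H K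

/-- The coefficient of `z⁻²` in the dressing matrix. -/
def dressTwo : Matrix (Fin 2) (Fin 2) ℂ := -(dressX l m H K * (Matrix.diagonal m * K))

/-- The constant term of the dressed generator in the `x` direction. -/
def dressedZero (Q : Matrix (Fin 2) (Fin 2) ℂ) : Matrix (Fin 2) (Fin 2) ℂ :=
  dressOne l m H K * Q - (Q + dressComm l m H K) * dressOne l m H K +
    (dressTwo l m H K * sigma3 - sigma3 * dressTwo l m H K)

/-- The dressed generator in the `x` direction. -/
def dressedU (Q : Matrix (Fin 2) (Fin 2) ℂ) (z : ℂ) : Matrix (Fin 2) (Fin 2) ℂ :=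
  z • (z • sigma3 + (Q + dressComm l m H K)) + dressedZero l m H K Q

variable {l m H K} (hlm : ∀ α β, l β - m α ≠ 0) (hΓ : IsUnit (gram l m H K).det)
include hlm hΓ

lemma flowOne_const (C : Matrix (Fin 2) (Fin 2) ℂ) :
    flowOne l m H K (fun _ => C) = C * dressOne l m H K - dressOne l m H K * C := by
  simp only [flowOne, flowX_const, flowK_const, dressOne, Matrix.mul_neg, Matrix.neg_mul,
    Matrix.mul_assoc]

lemma isDressing_affine (Q : Matrix (Fin 2) (Fin 2) ℂ) :
    IsDressing l m H K (fun z => z • sigma3 + Q)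
      (fun z => z • sigma3 + (Q + dressComm l m H K)) := by
  have h := ((IsDressing.const (l := l) (m := m) (H := H) (K := K) sigma3).shift hlm hΓ).add
    (IsDressing.const Q)
  rw [flowOne_const hlm hΓ] at h
  convert h using 1
  · rfl
  · funext z
    change _ = z • sigma3 - (sigma3 * dressOne l m H K - dressOne l m H K * sigma3) + Q
    rw [dressComm]
    abel

lemma flowOne_affine (Q : Matrix (Fin 2) (Fin 2) ℂ) :
    flowOne l m H K (fun z => z • sigma3 + Q) = -dressedZero l m H K Q := by
  have h : (fun z : ℂ => z • sigma3 + Q) = (fun z => z • (fun _ => sigma3) z) + fun _ => Q := rfl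
  rw [h, flowOne_add, flowOne_const hlm hΓ, flowOne, flowX_shift hlm hΓ, flowX_const, flowK_shift,
    flowK_const, flowOne_const hlm hΓ]
  simp only [dressedZero, dressComm, dressTwo, dressOne, Matrix.mul_neg, Matrix.neg_mul,
    Matrix.sub_mul, Matrix.add_mul, Matrix.mul_assoc]
  abel

lemma isDressing_laxU (q r : ℝ × ℝ → ℂ) (p : ℝ × ℝ) :
    IsDressing l m H K (fun z => laxU q r z p) (dressedU l m H K (offDiag (q p) (r p))) := by
  have h := (isDressing_affine hlm hΓ (offDiag (q p) (r p))).shift hlm hΓ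
  rw [flowOne_affine hlm hΓ] at h
  simp only [sub_neg_eq_add] at h
  simp only [laxU_eq]
  exact h

lemma IsDressing.exists_shift {A W : ℂ → Matrix (Fin 2) (Fin 2) ℂ} (h : IsDressing l m H K A W) :
    ∃ v, IsDressing l m H K (fun z => z • A z) (fun z => z • W z + v) :=
  ⟨-flowOne l m H K A, by simpa only [sub_eq_add_neg] using h.shift hlm hΓ⟩

/-- The constant term `v` need not be computed, since the gauge by `F` removes it. -/
lemma isDressing_laxV (q r : ℝ × ℝ → ℂ) (p : ℝ × ℝ) : ∃ v : Matrix (Fin 2) (Fin 2) ℂ,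
    IsDressing l m H K (fun z => laxV q r z p) (fun z =>
      z • ((-2 * Complex.I) • (z • dressedU l m H K (offDiag (q p) (r p)) z -
          flowOne l m H K (fun z => laxU q r z p)) +
        (Complex.I * q p * r p) • (z • sigma3 + dressComm l m H K) + laxVOne q r p) + v) := by
  have h1 := ((isDressing_laxU hlm hΓ q r p).shift hlm hΓ).smul (-2 * Complex.I)
  have h2 := (isDressing_affine hlm hΓ 0).smul (Complex.I * q p * r p)
  obtain ⟨v, h⟩ := ((h1.add h2).add (IsDressing.const (laxVOne q r p))).exists_shift hlm hΓ
  refine ⟨v, ?_⟩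
  convert h using 1
  · funext z
    simp only [laxV_eq, Pi.add_apply, Pi.smul_apply, add_zero]
  · funext z
    simp only [Pi.add_apply, Pi.smul_apply, zero_add]

end DressedPair

/-- The derivative of `F⁻¹` contributes `-F⁻¹ W0`, which turns the generator `W` into `F⁻¹ (W - W0)
F`. -/
lemma gauge_intertwine {F S S' U F' W W0 Ũ : Matrix (Fin 2) (Fin 2) ℂ} (hF : IsUnit F)
    (h0 : F' = W0 * F) (h : S' + S * U = W * S) (hg : F⁻¹ * (W - W0) = Ũ * F⁻¹) :
    (F⁻¹ * S) * U + (-(F⁻¹ * (F' * F⁻¹)) * S + F⁻¹ * S') = Ũ * (F⁻¹ * S) := by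
  have hF' : F * F⁻¹ = 1 := Matrix.mul_nonsing_inv _ ((Matrix.isUnit_iff_isUnit_det _).1 hF)
  rw [← Matrix.mul_assoc Ũ, ← hg, h0, Matrix.mul_assoc W0, hF', Matrix.mul_one,
      Matrix.mul_assoc F⁻¹ S U,
    Matrix.mul_assoc F⁻¹ _ S, Matrix.sub_mul, ← h]
  simp only [Matrix.mul_sub, Matrix.mul_add, Matrix.neg_mul, Matrix.mul_assoc]
  abel

/-- The gauge transformation of the dressed generators by a diagonal matrix. -/
lemma gauge_lax {q r q' r' : ℝ × ℝ → ℂ} {p : ℝ × ℝ} {S₁ S₁' R F F' : Matrix (Fin 2) (Fin 2) ℂ}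
    {D : Matrix (Fin 2) (Fin 2) ℂ}
    (hS₁ : ∀ i, S₁ i i = 0) (hS₁' : ∀ i, S₁' i i = 0) (hF : F.IsDiag) (hF' : F'.IsDiag)
    (hFu : IsUnit F) (hRF : F' = R * F)
    (hR : R = S₁ * offDiag (q p) (r p) -
      (offDiag (q p) (r p) + (S₁ * sigma3 - sigma3 * S₁)) * S₁ + (D * sigma3 - sigma3 * D))
    (hq : q' p = F 1 1 / F 0 0 * (q p - 2 * S₁ 0 1))
    (hr : r' p = F 0 0 / F 1 1 * (r p + 2 * S₁ 1 0))
    (hqx : dx q' p = (F' 1 1 * F 0 0 - F 1 1 * F' 0 0) / F 0 0 ^ 2 * (q p - 2 * S₁ 0 1) +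
      F 1 1 / F 0 0 * (dx q p - 2 * S₁' 0 1))
    (hrx : dx r' p = (F' 0 0 * F 1 1 - F 0 0 * F' 1 1) / F 1 1 ^ 2 * (r p + 2 * S₁ 1 0) +
      F 0 0 / F 1 1 * (dx r p + 2 * S₁' 1 0)) (z : ℂ) :
    F⁻¹ * (z • (z • sigma3 + (offDiag (q p) (r p) + (S₁ * sigma3 - sigma3 * S₁)))) =
      laxU q' r' z p * F⁻¹ ∧
    F⁻¹ * (z • ((-2 * Complex.I) • (z • (z • (z • sigma3 + (offDiag (q p) (r p) +
          (S₁ * sigma3 - sigma3 * S₁))) + R) - S₁') +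
        (Complex.I * q p * r p) • (z • sigma3 + (S₁ * sigma3 - sigma3 * S₁)) + laxVOne q r p)) =
      laxV q' r' z p * F⁻¹ := by
  have hdet := (Matrix.isUnit_iff_isUnit_det _).1 hFu
  have hF01 : F 0 1 = 0 := hF (by simp)
  have hF10 : F 1 0 = 0 := hF (by simp)
  have hne : F 0 0 * F 1 1 ≠ 0 := by
    have := hdet.ne_zero
    rwa [Matrix.det_fin_two, hF01, zero_mul, sub_zero] at this
  have h00 : F 0 0 ≠ 0 := left_ne_zero_of_mul hne
  have h11 : F 1 1 ≠ 0 := right_ne_zero_of_mul hne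
  have hinv : F⁻¹ = !![(F 0 0)⁻¹, 0; 0, (F 1 1)⁻¹] := by
    refine Matrix.inv_eq_left_inv ?_
    ext i j; fin_cases i <;> fin_cases j <;> simp [Matrix.mul_apply, hF01, hF10, h00, h11]
  obtain ⟨a, ha⟩ : ∃ a, a = S₁ 0 1 := ⟨_, rfl⟩
  obtain ⟨b, hb⟩ : ∃ b, b = S₁ 1 0 := ⟨_, rfl⟩
  obtain ⟨a', ha'⟩ : ∃ a, a = S₁' 0 1 := ⟨_, rfl⟩
  obtain ⟨b', hb'⟩ : ∃ b, b = S₁' 1 0 := ⟨_, rfl⟩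
  have eS : S₁ = offDiag a b := by
    ext i j; fin_cases i <;> fin_cases j <;> simp [offDiag, hS₁, ha, hb]
  have eS' : S₁' = offDiag a' b' := by
    ext i j; fin_cases i <;> fin_cases j <;> simp [offDiag, hS₁', ha', hb']
  have e01 := congrFun (congrFun hRF 0) 1
  have e10 := congrFun (congrFun hRF 1) 0
  have e00 := congrFun (congrFun hRF 0) 0
  have e11 := congrFun (congrFun hRF 1) 1
  rw [hF' (by simp)] at e01 e10
  simp only [Matrix.mul_apply, Fin.sum_univ_two, hF01, hF10, mul_zero, zero_add, add_zero,
    zero_eq_mul, h00, h11, or_false] at e01 e10 e00 e11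
  -- The commutator of `D` with `σ₃` has zero diagonal, so the `z⁻²` coefficient of `S` drops out.
  -- As `R = F' F⁻¹` is diagonal, it becomes an explicit multiple of `σ₃`; this yields `q' r' = (q -
  -- 2a)(r + 2b) = q r - 2 R₀₀`, the match required at order `z²` in `V`.
  have r00 : R 0 0 = a * r p - (q p - 2 * a) * b := by
    rw [hR, eS, Matrix.eta_fin_two D]; simp [offDiag, sigma3]; left; ring
  have r11 : R 1 1 = -(a * r p - (q p - 2 * a) * b) := by
    rw [hR, eS, Matrix.eta_fin_two D]; simp [offDiag, sigma3]; ring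
  have eR : R = (a * r p - (q p - 2 * a) * b) • sigma3 := by
    ext i j; fin_cases i <;> fin_cases j <;> simp [sigma3, r00, r11, e01, e10]
  rw [r00] at e00
  rw [r11] at e11
  rw [← ha] at hq
  rw [← hb] at hr
  rw [e00, e11, ← ha, ← ha'] at hqx
  rw [e00, e11, ← hb, ← hb'] at hrx
  rw [hinv, eS, eS', eR]
  constructor
  · ext i j; fin_cases i <;> fin_cases j <;>
      simp [Matrix.mul_apply, offDiag, sigma3, laxU, hq, hr] <;> field_simp <;> ring
  · ext i j; fin_cases i <;> fin_cases j <;>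
      simp [Matrix.mul_apply, offDiag, sigma3, laxV, laxVOne, hq, hr, hqx,
          hrx] <;> field_simp <;> ring

section

/-! ### The Darboux matrix of the nonlocal equation -/

/-- The standing assumptions: a reflection invariant domain, a potential of class `C^k`, admissible
spectral parameters, and solutions of the Lax pair. -/
structure IsDarbouxData (k : ℕ∞) (ε : ℂ) (Ω : Set (ℝ × ℝ)) (q : ℝ × ℝ → ℂ) {n : ℕ}
    (μ : Fin n → ℂ) (ξ η : Fin n → ℝ × ℝ → ℂ) : Prop where
  two_le : 2 ≤ k
  eps : ε = 1 ∨ ε = -1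
  isOpen : IsOpen Ω
  symm : ∀ p ∈ Ω, reflect p ∈ Ω
  contDiffOn : ContDiffOn ℝ (k : WithTop ℕ∞) q Ω
  im_ne : ∀ j, (μ j ^ 2).im ≠ 0
  conj_ne : ∀ i j, i ≠ j → starRingEnd ℂ (μ i) ^ 2 ≠ μ j ^ 2
  lax : ∀ j, IsLaxSolution q (reduction ε q) (μ j) (ξ j) (η j) Ω

variable {k : ℕ∞} {ε : ℂ} {Ω : Set (ℝ × ℝ)} {q : ℝ × ℝ → ℂ} {n : ℕ} {μ : Fin n → ℂ}
  {ξ η : Fin n → ℝ × ℝ → ℂ}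

lemma lam_sq (α : Fin n × Fin 2) : lam μ α ^ 2 = μ α.1 ^ 2 := by
  rw [lam]; split_ifs <;> ring

namespace IsDarbouxData

variable (h : IsDarbouxData k ε Ω q μ ξ η)
include h

lemma lam_ne_zero (α : Fin n × Fin 2) : lam μ α ≠ 0 := by
  intro h0
  have h1 := h.im_ne α.1
  rw [← lam_sq, h0] at h1
  simp at h1

lemma lam_sub_pole (α β : Fin n × Fin 2) : lam μ β - pole μ α ≠ 0 := by
  intro h0
  have h1 : lam μ β ^ 2 = conj (lam μ α) ^ 2 := by
    rw [sub_eq_zero.1 h0, pole, neg_sq]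
  rw [← map_pow, lam_sq, lam_sq] at h1
  by_cases hij : α.1 = β.1
  · rw [hij] at h1
    exact h.im_ne β.1 (Complex.conj_eq_iff_im.1 h1.symm)
  · exact h.conj_ne _ _ hij (by rw [← map_pow, h1])

lemma one_le : (1 : WithTop ℕ∞) ≤ k := by
  exact_mod_cast (le_trans (by norm_num) h.two_le)

lemma two_le' : (2 : WithTop ℕ∞) ≤ k := WithTop.coe_le_coe.2 h.two_le

lemma ne_zero : (k : WithTop ℕ∞) ≠ 0 := (lt_of_lt_of_le zero_lt_one h.one_le).ne'

lemma contDiffOn_reduction : ContDiffOn ℝ (k : WithTop ℕ∞) (reduction ε q) Ω :=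
  NonlocalDNLS.contDiffOn_reduction h.symm h.contDiffOn

lemma contDiffOn_matH (i : Fin 2) (α : Fin n × Fin 2) :
    ContDiffOn ℝ (k : WithTop ℕ∞) (fun p => matH ξ η p i α) Ω := by
  have h1 := (isLaxSolution_all h.lax α).contDiffOn h.isOpen h.contDiffOn h.contDiffOn_reduction
  fin_cases i
  · exact h1.1
  · exact h1.2

lemma contDiffOn_matK (α : Fin n × Fin 2) (i : Fin 2) :
    ContDiffOn ℝ (k : WithTop ℕ∞) (fun p => matK ε ξ η p α i) Ω := by
  simp only [matK_apply]
  exact contDiffOn_const.mul (contDiffOn_barConj h.symm (h.contDiffOn_matH i α))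

lemma contDiffOn_Gam (α β : Fin n × Fin 2) :
    ContDiffOn ℝ (k : WithTop ℕ∞) (fun p => Gam ε μ ξ η p α β) Ω := by
  simp only [Gam_eq_gram, gram, cauchyDiv, Matrix.of_apply, Matrix.mul_apply]
  exact (ContDiffOn.sum fun i _ => (h.contDiffOn_matK α i).mul (h.contDiffOn_matH i β)).div_const _

lemma isOpen_regularSet : IsOpen (regularSet ε μ ξ η Ω) := by
  have h1 := (contDiffOn_det h.contDiffOn_Gam).continuousOn.isOpen_inter_preimage h.isOpen
    (isOpen_compl_singleton (x := (0 : ℂ)))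
  exact h1

lemma reflect_mem {p : ℝ × ℝ} (hp : p ∈ regularSet ε μ ξ η Ω) :
    reflect p ∈ regularSet ε μ ξ η Ω := regularSet_reflect h.eps h.symm hp

lemma contDiffOn_dressX (i : Fin 2) (α : Fin n × Fin 2) : ContDiffOn ℝ (k : WithTop ℕ∞)
    (fun p => dressX (lam μ) (pole μ) (matH ξ η p) (matK ε ξ η p) i α) (regularSet ε μ ξ η Ω) := by
  have hs : regularSet ε μ ξ η Ω ⊆ Ω := fun p hp => hp.1
  simp only [dressX, ← Gam_eq_gram, Matrix.mul_apply]
  exact ContDiffOn.sum fun β _ => ((h.contDiffOn_matH i β).mono hs).mul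
    (contDiffOn_inv_entry (fun α β => (h.contDiffOn_Gam α β).mono hs) (fun p hp => hp.2) β α)

lemma contDiffOn_dressX_mul (w : Fin n × Fin 2 → ℂ) (i j : Fin 2) : ContDiffOn ℝ (k : WithTop ℕ∞)
    (fun p => (dressX (lam μ) (pole μ) (matH ξ η p) (matK ε ξ η p) *
      (Matrix.diagonal w * matK ε ξ η p)) i j) (regularSet ε μ ξ η Ω) := by
  have hs : regularSet ε μ ξ η Ω ⊆ Ω := fun p hp => hp.1
  simp only [Matrix.mul_apply]
  exact ContDiffOn.sum fun β _ => (h.contDiffOn_dressX i β).mul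
    (ContDiffOn.sum fun γ _ => contDiffOn_const.mul ((h.contDiffOn_matK γ j).mono hs))

lemma contDiffOn_matF (i j : Fin 2) : ContDiffOn ℝ (k : WithTop ℕ∞)
    (fun p => matF ε μ ξ η p i j) (regularSet ε μ ξ η Ω) := by
  simp only [matF_eq_dressS, dressS, Matrix.sub_apply]
  exact contDiffOn_const.sub (h.contDiffOn_dressX_mul _ i j)

lemma contDiffOn_dressOne (i j : Fin 2) : ContDiffOn ℝ (k : WithTop ℕ∞)
    (fun p => dressOne (lam μ) (pole μ) (matH ξ η p) (matK ε ξ η p) i j)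
    (regularSet ε μ ξ η Ω) := by
  have h1 := (h.contDiffOn_dressX_mul (fun _ => 1) i j).neg
  simp only [Matrix.diagonal_one, Matrix.one_mul] at h1
  exact h1

lemma isUnit_F {p : ℝ × ℝ} (hp : p ∈ regularSet ε μ ξ η Ω) : IsUnit (matF ε μ ξ η p) :=
  isUnit_matF h.lam_sub_pole h.lam_ne_zero hp.2

lemma matF_ne_zero {p : ℝ × ℝ} (hp : p ∈ regularSet ε μ ξ η Ω) (i : Fin 2) :
    matF ε μ ξ η p i i ≠ 0 :=
  left_ne_zero_of_mul (ne_of_eq_of_ne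
    (matF_mul_conj_reflect h.lam_sub_pole h.lam_ne_zero h.eps hp.2 i) one_ne_zero)

lemma contDiffOn_newPotential : ContDiffOn ℝ (k : WithTop ℕ∞) (newPotential ε μ ξ η q)
    (regularSet ε μ ξ η Ω) := by
  refine ContDiffOn.congr ?_ fun p _ => newPotential_eq ε μ ξ η q p
  simp only [div_eq_mul_inv]
  exact ((h.contDiffOn_matF 1 1).mul
    ((h.contDiffOn_matF 0 0).inv fun p hp => h.matF_ne_zero hp 0)).mul
    ((h.contDiffOn.mono fun p hp => hp.1).sub (contDiffOn_const.mul (h.contDiffOn_dressOne 0 1)))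

lemma reduction_newPotential {p : ℝ × ℝ} (hp : p ∈ regularSet ε μ ξ η Ω) :
    reduction ε (newPotential ε μ ξ η q) p = matF ε μ ξ η p 0 0 / matF ε μ ξ η p 1 1 *
      (reduction ε q p + 2 * dressOne (lam μ) (pole μ) (matH ξ η p) (matK ε ξ η p) 1 0) := by
  have e (i : Fin 2) : conj (matF ε μ ξ η (reflect p) i i) = (matF ε μ ξ η p i i)⁻¹ :=
    eq_inv_of_mul_eq_one_right
      (matF_mul_conj_reflect h.lam_sub_pole h.lam_ne_zero h.eps hp.2 i)
  rw [reduction, barConj, newPotential_eq, map_mul, map_div₀, e, e, dressOne_one_zero h.eps,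
      map_sub,
    map_mul, map_ofNat, inv_div_inv, reduction, barConj]
  ring

section Derivatives

variable {p : ℝ × ℝ} (hp : p ∈ regularSet ε μ ξ η Ω)
include hp

lemma eventually_mem_x : ∀ᶠ s in nhds p.1, (s, p.2) ∈ regularSet ε μ ξ η Ω := by
  have hc : ContinuousAt (fun s : ℝ => (s, p.2)) p.1 := by fun_prop
  exact hc.eventually (h.isOpen_regularSet.mem_nhds hp)

lemma gram_det_ne_zero :
    (gram (lam μ) (pole μ) (matH ξ η p) (matK ε ξ η p)).det ≠ 0 := by
  rw [← Gam_eq_gram]; exact hp.2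

lemma hasMatDerivAt_dressS_x (z : ℂ) :
    HasMatDerivAt (fun s => dressS (lam μ) (pole μ) (matH ξ η (s, p.2)) (matK ε ξ η (s, p.2)) z)
      (flowS (lam μ) (pole μ) (matH ξ η p) (matK ε ξ η p)
        (fun z => laxU q (reduction ε q) z p) z) p.1 :=
  hasMatDerivAt_dressS (H := fun s => matH ξ η (s, p.2)) (K := fun s => matK ε ξ η (s, p.2))
    (hasMatDerivAt_matH_x h.isOpen h.lax hp.1)
    (hasMatDerivAt_matK_x h.isOpen h.symm h.eps h.lax hp.1) (h.gram_det_ne_zero hp) z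

lemma hasMatDerivAt_dressS_t (z : ℂ) :
    HasMatDerivAt (fun s => dressS (lam μ) (pole μ) (matH ξ η (p.1, s)) (matK ε ξ η (p.1, s)) z)
      (flowS (lam μ) (pole μ) (matH ξ η p) (matK ε ξ η p)
        (fun z => laxV q (reduction ε q) z p) z) p.2 :=
  hasMatDerivAt_dressS (H := fun s => matH ξ η (p.1, s)) (K := fun s => matK ε ξ η (p.1, s))
    (hasMatDerivAt_matH_t h.isOpen h.lax hp.1)
    (hasMatDerivAt_matK_t h.isOpen h.symm h.eps h.lax hp.1 (h.contDiffOn.differentiableOn h.ne_zero))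
    (h.gram_det_ne_zero hp) z

lemma hasMatDerivAt_matF_x : HasMatDerivAt (fun s => matF ε μ ξ η (s, p.2))
    (flowS (lam μ) (pole μ) (matH ξ η p) (matK ε ξ η p)
        (fun z => laxU q (reduction ε q) z p) 0) p.1 := by
  simp only [matF_eq_dressS]
  exact h.hasMatDerivAt_dressS_x hp 0

lemma hasMatDerivAt_matF_t : HasMatDerivAt (fun s => matF ε μ ξ η (p.1, s))
    (flowS (lam μ) (pole μ) (matH ξ η p) (matK ε ξ η p)
        (fun z => laxV q (reduction ε q) z p) 0) p.2 := by
  simp only [matF_eq_dressS]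
  exact h.hasMatDerivAt_dressS_t hp 0

lemma hasMatDerivAt_dressOne_x :
    HasMatDerivAt (fun s => dressOne (lam μ) (pole μ) (matH ξ η (s, p.2)) (matK ε ξ η (s, p.2)))
      (flowOne (lam μ) (pole μ) (matH ξ η p) (matK ε ξ η p)
        (fun z => laxU q (reduction ε q) z p)) p.1 :=
  hasMatDerivAt_dressOne (hasMatDerivAt_matH_x h.isOpen h.lax hp.1)
    (hasMatDerivAt_matK_x h.isOpen h.symm h.eps h.lax hp.1) (h.gram_det_ne_zero hp)

lemma dx_newPotential {F' S₁' : Matrix (Fin 2) (Fin 2) ℂ}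
    (hF' : HasMatDerivAt (fun s => matF ε μ ξ η (s, p.2)) F' p.1)
    (hS₁' : HasMatDerivAt (fun s => dressOne (lam μ) (pole μ) (matH ξ η (s, p.2))
      (matK ε ξ η (s, p.2))) S₁' p.1) :
    dx (newPotential ε μ ξ η q) p =
      (F' 1 1 * matF ε μ ξ η p 0 0 - matF ε μ ξ η p 1 1 * F' 0 0) / matF ε μ ξ η p 0 0 ^ 2 *
        (q p - 2 * dressOne (lam μ) (pole μ) (matH ξ η p) (matK ε ξ η p) 0 1) +
      matF ε μ ξ η p 1 1 / matF ε μ ξ η p 0 0 * (dx q p - 2 * S₁' 0 1) := by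
  have hq := hasDerivAt_dx ((h.contDiffOn.contDiffAt (h.isOpen.mem_nhds hp.1)).differentiableAt h.ne_zero)
  have h1 := ((hF' 1 1).div (hF' 0 0) (h.matF_ne_zero hp 0)).mul (hq.sub ((hS₁' 0 1).const_mul 2))
  refine HasDerivAt.deriv (h1.congr_of_eventuallyEq ?_)
  exact Filter.Eventually.of_forall fun s => newPotential_eq ε μ ξ η q (s, p.2)

lemma dx_reduction_newPotential {F' S₁' : Matrix (Fin 2) (Fin 2) ℂ}
    (hF' : HasMatDerivAt (fun s => matF ε μ ξ η (s, p.2)) F' p.1)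
    (hS₁' : HasMatDerivAt (fun s => dressOne (lam μ) (pole μ) (matH ξ η (s, p.2))
      (matK ε ξ η (s, p.2))) S₁' p.1) :
    dx (reduction ε (newPotential ε μ ξ η q)) p =
      (F' 0 0 * matF ε μ ξ η p 1 1 - matF ε μ ξ η p 0 0 * F' 1 1) / matF ε μ ξ η p 1 1 ^ 2 *
        (reduction ε q p + 2 * dressOne (lam μ) (pole μ) (matH ξ η p) (matK ε ξ η p) 1 0) +
      matF ε μ ξ η p 0 0 / matF ε μ ξ η p 1 1 * (dx (reduction ε q) p + 2 * S₁' 1 0) := by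
  have hq := hasDerivAt_dx
    ((h.contDiffOn_reduction.contDiffAt (h.isOpen.mem_nhds hp.1)).differentiableAt h.ne_zero)
  have h1 := ((hF' 0 0).div (hF' 1 1) (h.matF_ne_zero hp 1)).mul (hq.add ((hS₁' 1 0).const_mul 2))
  refine HasDerivAt.deriv (h1.congr_of_eventuallyEq ?_)
  filter_upwards [h.eventually_mem_x hp] with s hs
  exact h.reduction_newPotential hs

lemma zero_sub_pole (α : Fin n × Fin 2) : 0 - pole μ α ≠ 0 := by
  simpa [pole] using h.lam_ne_zero α

/-- The intertwining relations for `F⁻¹ S(z)` at the regular values `z`. -/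
lemma intertwine {z : ℂ} (hz : ∀ α, z - pole μ α ≠ 0) :
    HasMatDerivAt (fun s => (matF ε μ ξ η (s, p.2))⁻¹ *
        dressS (lam μ) (pole μ) (matH ξ η (s, p.2)) (matK ε ξ η (s, p.2)) z)
      (laxU (newPotential ε μ ξ η q) (reduction ε (newPotential ε μ ξ η q)) z p *
          ((matF ε μ ξ η p)⁻¹ * dressS (lam μ) (pole μ) (matH ξ η p) (matK ε ξ η p) z) -
        (matF ε μ ξ η p)⁻¹ * dressS (lam μ) (pole μ) (matH ξ η p) (matK ε ξ η p) z *
          laxU q (reduction ε q) z p) p.1 ∧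
    HasMatDerivAt (fun s => (matF ε μ ξ η (p.1, s))⁻¹ *
        dressS (lam μ) (pole μ) (matH ξ η (p.1, s)) (matK ε ξ η (p.1, s)) z)
      (laxV (newPotential ε μ ξ η q) (reduction ε (newPotential ε μ ξ η q)) z p *
          ((matF ε μ ξ η p)⁻¹ * dressS (lam μ) (pole μ) (matH ξ η p) (matK ε ξ η p) z) -
        (matF ε μ ξ η p)⁻¹ * dressS (lam μ) (pole μ) (matH ξ η p) (matK ε ξ η p) z *
          laxV q (reduction ε q) z p) p.2 := by
  have hΓ := isUnit_iff_ne_zero.2 (h.gram_det_ne_zero hp)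
  have hFu := h.isUnit_F hp
  have hdet := ((Matrix.isUnit_iff_isUnit_det _).1 hFu).ne_zero
  have hFx := h.hasMatDerivAt_matF_x hp
  have hFt := h.hasMatDerivAt_matF_t hp
  have hSx := h.hasMatDerivAt_dressS_x hp z
  have hSt := h.hasMatDerivAt_dressS_t hp z
  have hS₁ := h.hasMatDerivAt_dressOne_x hp
  have dU := isDressing_laxU h.lam_sub_pole hΓ q (reduction ε q) p
  obtain ⟨v, dV⟩ := isDressing_laxV h.lam_sub_pole hΓ q (reduction ε q) p
  have hU0 : laxU q (reduction ε q) 0 p = 0 := by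
    rw [laxU_eq, zero_smul]
  have hV0 : laxV q (reduction ε q) 0 p = 0 := by
    rw [laxV_eq, zero_smul]
  -- At `z = 0` both Lax matrices vanish, so the dressing relations reduce to `F_x = W_U(0) F` and
  -- `F_t = W_V(0) F`.
  have eU0 := dU 0 (h.zero_sub_pole hp)
  have eV0 := dV 0 (h.zero_sub_pole hp)
  simp only [hU0, hV0, Matrix.mul_zero, add_zero, ← matF_eq_dressS, dressedU, zero_smul,
      zero_add] at eU0 eV0
  have hdiagF : ∀ p, (matF ε μ ξ η p).IsDiag := matF_isDiag ε μ ξ η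
  have hF'd : (flowS (lam μ) (pole μ) (matH ξ η p) (matK ε ξ η p)
      (fun z => laxU q (reduction ε q) z p) 0).IsDiag := by
    intro i j hij
    have h1 := hFx i j
    simp only [hdiagF _ hij] at h1
    exact h1.unique (hasDerivAt_const _ _)
  have hS₁'d : ∀ i, flowOne (lam μ) (pole μ) (matH ξ η p) (matK ε ξ η p)
      (fun z => laxU q (reduction ε q) z p) i i = 0 := by
    intro i
    have h1 := hS₁ i i
    simp only [dressOne_diag] at h1
    exact h1.unique (hasDerivAt_const _ _)
  obtain ⟨gU, gV⟩ := gauge_lax (dressOne_diag ε μ ξ η p) hS₁'d (hdiagF p) hF'd hFu eU0 rfl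
    (newPotential_eq ε μ ξ η q p) (h.reduction_newPotential hp) (h.dx_newPotential hp hFx hS₁)
    (h.dx_reduction_newPotential hp hFx hS₁) z
  constructor
  · have h1 := (hFx.inv hdet).mul hSx
    have h2 := gauge_intertwine hFu eU0 (dU z hz) (by rw [dressedU, add_sub_cancel_right]; exact gU)
    rwa [← eq_sub_iff_add_eq.2 ((add_comm _ _).trans h2)]
  · have h1 := (hFt.inv hdet).mul hSt
    have h2 := gauge_intertwine hFu eV0 (dV z hz) (by rw [add_sub_cancel_right]; exact gV)
    rwa [← eq_sub_iff_add_eq.2 ((add_comm _ _).trans h2)]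

end Derivatives

end IsDarbouxData

end

section

/-! ### Zero curvature -/

lemma HasMatDerivAt.matDx_eq {G : ℝ × ℝ → Matrix (Fin 2) (Fin 2) ℂ} {p : ℝ × ℝ}
    {G' : Matrix (Fin 2) (Fin 2) ℂ} (h : HasMatDerivAt (fun s => G (s, p.2)) G' p.1) :
    matDx G p = G' := by
  ext i j; exact (h i j).deriv

lemma HasMatDerivAt.matDt_eq {G : ℝ × ℝ → Matrix (Fin 2) (Fin 2) ℂ} {p : ℝ × ℝ}
    {G' : Matrix (Fin 2) (Fin 2) ℂ} (h : HasMatDerivAt (fun s => G (p.1, s)) G' p.2) :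
    matDt G p = G' := by
  ext i j; exact (h i j).deriv

lemma dt_dx_comm {g : ℝ × ℝ → ℂ} {S : Set (ℝ × ℝ)} (hS : IsOpen S) (hg : ContDiffOn ℝ 2 g S)
    {p : ℝ × ℝ} (hp : p ∈ S) : dt (dx g) p = dx (dt g) p := by
  have hga : ∀ p ∈ S, ContDiffAt ℝ 2 g p := fun p hp => hg.contDiffAt (hS.mem_nhds hp)
  have hd : DifferentiableAt ℝ (fderiv ℝ g) p :=
    ((hga p hp).fderiv_right (m := 1) (by norm_num [one_add_one_eq_two])).differentiableAt (by simp)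
  have hv (v : ℝ × ℝ) : HasFDerivAt (fun p => fderiv ℝ g p v)
      ((fderiv ℝ (fderiv ℝ g) p).flip v) p := by
    have := hd.hasFDerivAt.clm_apply (hasFDerivAt_const v p)
    simpa using this
  have ex : dx g =ᶠ[nhds p] fun p => fderiv ℝ g p (1, 0) := by
    filter_upwards [hS.mem_nhds hp] with p' hp'
    exact dx_eq_fderiv ((hga p' hp').differentiableAt (by simp))
  have et : dt g =ᶠ[nhds p] fun p => fderiv ℝ g p (0, 1) := by
    filter_upwards [hS.mem_nhds hp] with p' hp'
    exact dt_eq_fderiv ((hga p' hp').differentiableAt (by simp))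
  have fx := (hv (1, 0)).congr_of_eventuallyEq ex
  have ft := (hv (0, 1)).congr_of_eventuallyEq et
  rw [dt_eq_fderiv fx.differentiableAt, dx_eq_fderiv ft.differentiableAt, fx.fderiv, ft.fderiv]
  exact ((hga p hp).isSymmSndFDerivAt (by simp)).eq _ _

/-- Differentiate `G_x = U' G - G U` in `t` and `G_t = V' G - G V` in `x`, and equate the mixed
partials. -/
lemma zero_curvature {S : Set (ℝ × ℝ)} (hS : IsOpen S)
    {G U V U' V' : ℝ × ℝ → Matrix (Fin 2) (Fin 2) ℂ}
    (hG : ∀ i j, ContDiffOn ℝ 2 (fun p => G p i j) S)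
    (hx : ∀ p ∈ S, HasMatDerivAt (fun s => G (s, p.2)) (U' p * G p - G p * U p) p.1)
    (ht : ∀ p ∈ S, HasMatDerivAt (fun s => G (p.1, s)) (V' p * G p - G p * V p) p.2)
    {p : ℝ × ℝ} (hp : p ∈ S) {Ut Vx Ut' Vx' : Matrix (Fin 2) (Fin 2) ℂ}
    (hU : HasMatDerivAt (fun s => U (p.1, s)) Ut p.2)
    (hV : HasMatDerivAt (fun s => V (s, p.2)) Vx p.1)
    (hU' : HasMatDerivAt (fun s => U' (p.1, s)) Ut' p.2)
    (hV' : HasMatDerivAt (fun s => V' (s, p.2)) Vx' p.1) :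
    (Ut' - Vx' + U' p * V' p - V' p * U' p) * G p =
      G p * (Ut - Vx + U p * V p - V p * U p) := by
  have hGx := hx p hp
  have hGt := ht p hp
  have h1 := (hU'.mul hGt).sub (hGt.mul hU)
  have h2 := (hV'.mul hGx).sub (hGx.mul hV)
  have ex : ∀ᶠ s in nhds p.2, (p.1, s) ∈ S :=
    (show ContinuousAt (fun s : ℝ => (p.1, s)) p.2 by fun_prop).eventually (hS.mem_nhds hp)
  have et : ∀ᶠ s in nhds p.1, (s, p.2) ∈ S :=
    (show ContinuousAt (fun s : ℝ => (s, p.2)) p.1 by fun_prop).eventually (hS.mem_nhds hp)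
  have key : Ut' * G p + U' p * (V' p * G p - G p * V p) -
      ((V' p * G p - G p * V p) * U p + G p * Ut) =
      Vx' * G p + V' p * (U' p * G p - G p * U p) -
      ((U' p * G p - G p * U p) * V p + G p * Vx) := by
    ext i j
    have e1 : dt (dx fun p => G p i j) p = (Ut' * G p + U' p * (V' p * G p - G p * V p) -
        ((V' p * G p - G p * V p) * U p + G p * Ut)) i j := by
      refine HasDerivAt.deriv ((h1 i j).congr_of_eventuallyEq ?_)
      filter_upwards [ex] with s hs
      exact (hx _ hs i j).deriv
    have e2 : dx (dt fun p => G p i j) p = (Vx' * G p + V' p * (U' p * G p - G p * U p) -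
        ((U' p * G p - G p * U p) * V p + G p * Vx)) i j := by
      refine HasDerivAt.deriv ((h2 i j).congr_of_eventuallyEq ?_)
      filter_upwards [et] with s hs
      exact (ht _ hs i j).deriv
    rw [← e1, ← e2, dt_dx_comm hS (hG i j) hp]
  rw [← sub_eq_zero] at key ⊢
  rw [← key]
  noncomm_ring

/-- The defect of the first evolution equation of the coupled system. -/
def defectQ (q r : ℝ × ℝ → ℂ) (p : ℝ × ℝ) : ℂ :=
  dt q p + Complex.I * dx (dx q) p - Complex.I * dx (fun p => q p ^ 2 * r p) p

/-- The defect of the second evolution equation of the coupled system. -/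
def defectR (q r : ℝ × ℝ → ℂ) (p : ℝ × ℝ) : ℂ :=
  dt r p - Complex.I * dx (dx r) p - Complex.I * dx (fun p => q p * r p ^ 2) p

/-- Every power of `z` except the first cancels identically. -/
lemma lax_curvature {q r : ℝ × ℝ → ℂ} {S : Set (ℝ × ℝ)} (hS : IsOpen S) (hq : ContDiffOn ℝ 2 q S)
    (hr : ContDiffOn ℝ 2 r S) {p : ℝ × ℝ} (hp : p ∈ S) (z : ℂ) :
    ∃ Ut Vx, HasMatDerivAt (fun s => laxU q r z (p.1, s)) Ut p.2 ∧
      HasMatDerivAt (fun s => laxV q r z (s, p.2)) Vx p.1 ∧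
      Ut - Vx + laxU q r z p * laxV q r z p - laxV q r z p * laxU q r z p =
        z • offDiag (defectQ q r p) (defectR q r p) := by
  have dq := (hq.contDiffAt (hS.mem_nhds hp)).differentiableAt (by simp)
  have dr := (hr.contDiffAt (hS.mem_nhds hp)).differentiableAt (by simp)
  have dqx := ((contDiffOn_dx hS hq (m := 1) (by norm_num [one_add_one_eq_two])).contDiffAt
    (hS.mem_nhds hp)).differentiableAt (by simp)
  have drx := ((contDiffOn_dx hS hr (m := 1) (by norm_num [one_add_one_eq_two])).contDiffAt
    (hS.mem_nhds hp)).differentiableAt (by simp)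
  have hqx := hasDerivAt_dx dq
  have hrx := hasDerivAt_dx dr
  have hf := hasDerivAt_dx (f := fun p => q p ^ 2 * r p) ((dq.pow 2).mul dr)
  have hg := hasDerivAt_dx (f := fun p => q p * r p ^ 2) (dq.mul (dr.pow 2))
  have hqr := hqx.mul hrx
  have c (a : ℂ) (s : ℝ) := hasDerivAt_const s a
  refine ⟨!![0, z * dt q p; z * dt r p, 0],
    !![Complex.I * (dx q p * r p + q p * dx r p) * z ^ 2,
      -2 * Complex.I * dx q p * z ^ 3 +
        (-Complex.I * dx (dx q) p + Complex.I * dx (fun p => q p ^ 2 * r p) p) * z;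
      -2 * Complex.I * dx r p * z ^ 3 +
        (Complex.I * dx (dx r) p + Complex.I * dx (fun p => q p * r p ^ 2) p) * z,
      -(Complex.I * (dx q p * r p + q p * dx r p) * z ^ 2)], ?_, ?_, ?_⟩
  · intro i j
    fin_cases i <;> fin_cases j
    · exact c (z ^ 2) _
    · exact (hasDerivAt_dt dq).const_mul z
    · exact (hasDerivAt_dt dr).const_mul z
    · exact c (-z ^ 2) _
  · intro i j
    fin_cases i <;> fin_cases j
    · refine (((hqr.const_mul Complex.I).mul_const (z ^ 2)).const_add
        (-2 * Complex.I * z ^ 4)).congr_of_eventuallyEq (.of_forall fun s => ?_)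
      change -2 * Complex.I * z ^ 4 + Complex.I * q _ * r _ * z ^ 2 = _
      simp only [Pi.mul_apply]; ring
    · refine (((hqx.const_mul (-2 * Complex.I)).mul_const (z ^ 3)).add
        ((((hasDerivAt_dx dqx).const_mul (-Complex.I)).add
          (hf.const_mul Complex.I)).mul_const z)).congr_of_eventuallyEq (.of_forall fun s => ?_)
      change -2 * Complex.I * q _ * z ^ 3 +
        (-Complex.I * dx q _ + Complex.I * q _ ^ 2 * r _) * z = _
      simp only [Pi.add_apply]; ring
    · refine (((hrx.const_mul (-2 * Complex.I)).mul_const (z ^ 3)).add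
        ((((hasDerivAt_dx drx).const_mul Complex.I).add
          (hg.const_mul Complex.I)).mul_const z)).congr_of_eventuallyEq (.of_forall fun s => ?_)
      change -2 * Complex.I * r _ * z ^ 3 +
        (Complex.I * dx r _ + Complex.I * q _ * r _ ^ 2) * z = _
      simp only [Pi.add_apply]; ring
    · refine (((hqr.const_mul Complex.I).mul_const (z ^ 2)).const_sub
        (2 * Complex.I * z ^ 4)).congr_of_eventuallyEq (.of_forall fun s => ?_)
      change 2 * Complex.I * z ^ 4 - Complex.I * q _ * r _ * z ^ 2 = _
      simp only [Pi.mul_apply]; ring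
  · ext i j
    fin_cases i <;> fin_cases j <;>
      simp [laxU, laxV, offDiag, defectQ, defectR] <;> ring

lemma defectQ_reduction {ε : ℂ} {q : ℝ × ℝ → ℂ} (p : ℝ × ℝ) :
    Complex.I * dt q p = dx (dx q) p + ε * dx (fun p' => q p' ^ 2 * barConj q p') p ↔
      defectQ q (reduction ε q) p = 0 := by
  have h : dx (fun p => q p ^ 2 * reduction ε q p) p =
      -ε * dx (fun p' => q p' ^ 2 * barConj q p') p := by
    rw [dx, dx, ← deriv_const_mul_field]
    congr 1; funext s; rw [reduction]; ring
  rw [defectQ, h]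
  constructor
  · intro e
    linear_combination -Complex.I * e + (dt q p) * Complex.I_sq
  · intro e
    linear_combination Complex.I * e - (dx (dx q) p + ε * dx (fun p' => q p' ^ 2 * barConj q p') p) * Complex.I_sq

/-- Under the reduction the second equation is the reflected conjugate of the first, so the scalar
equation at all points implies the coupled system. -/
lemma defectR_reduction {ε : ℂ} (hε : ε = 1 ∨ ε = -1) {q : ℝ × ℝ → ℂ} {S : Set (ℝ × ℝ)}
    (hS : IsOpen S) (hSs : ∀ p ∈ S,
        reflect p ∈ S) (hq : ContDiffOn ℝ 2 q S) {p : ℝ × ℝ} (hp : p ∈ S) :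
    defectR q (reduction ε q) p = -ε * conj (defectQ q (reduction ε q) (reflect p)) := by
  have hp' := hSs p hp
  have dq : ∀ p ∈ S, DifferentiableAt ℝ q p := fun p hp =>
    (hq.contDiffAt (hS.mem_nhds hp)).differentiableAt (by simp)
  have dqx : ∀ p ∈ S, DifferentiableAt ℝ (dx q) p := fun p hp =>
    ((contDiffOn_dx hS hq (m := 1) (by norm_num [one_add_one_eq_two])).contDiffAt
    (hS.mem_nhds hp)).differentiableAt (by simp)
  have dr : DifferentiableAt ℝ (reduction ε q) (reflect p) :=
    ((contDiffOn_reduction hSs hq).contDiffAt (hS.mem_nhds hp')).differentiableAt (by simp)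
  have e1 : dt (reduction ε q) p = -ε * conj (dt q (reflect p)) :=
    ((hasDerivAt_dt_barConj (dq _ hp')).const_mul (-ε)).deriv
  have e2 : dx (dx (reduction ε q)) p = -ε * conj (dx (dx q) (reflect p)) := by
    have h := (hasDerivAt_dx_barConj (dqx _ hp')).const_mul ε
    rw [mul_neg, ← neg_mul] at h
    refine (h.congr_of_eventuallyEq ?_).deriv
    have et : ∀ᶠ s in nhds p.1, (s, p.2) ∈ S :=
      (show ContinuousAt (fun s : ℝ => (s, p.2)) p.1 by fun_prop).eventually (hS.mem_nhds hp)
    filter_upwards [et] with s hs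
    exact dx_reduction (dq _ (hSs _ hs))
  have e3 : dx (fun p => q p * reduction ε q p ^ 2) p =
      ε * conj (dx (fun p => q p ^ 2 * reduction ε q p) (reflect p)) := by
    have h := (hasDerivAt_dx_barConj (f := fun p => q p ^ 2 * reduction ε q p)
      (((dq _ hp').pow 2).mul dr)).const_mul (-ε)
    rw [neg_mul_neg] at h
    refine (h.congr_of_eventuallyEq (.of_forall fun s => ?_)).deriv
    simp only [reduction, barConj, reflect_reflect, map_mul, map_neg, map_pow, Complex.conj_conj,
        conj_eps hε]
    ring
  rw [defectR, e1, e2, e3, defectQ, map_sub, map_add, map_mul, map_mul, Complex.conj_I]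
  ring

variable {k : ℕ∞} {ε : ℂ} {Ω : Set (ℝ × ℝ)} {q : ℝ × ℝ → ℂ} {n : ℕ} {μ : Fin n → ℂ}
  {ξ η : Fin n → ℝ × ℝ → ℂ}

namespace IsDarbouxData

variable (h : IsDarbouxData k ε Ω q μ ξ η)
include h

lemma contDiffOn_matF_inv (i j : Fin 2) : ContDiffOn ℝ (k : WithTop ℕ∞)
    (fun p => (matF ε μ ξ η p)⁻¹ i j) (regularSet ε μ ξ η Ω) :=
  contDiffOn_inv_entry h.contDiffOn_matF
    (fun _ hp => ((Matrix.isUnit_iff_isUnit_det _).1 (h.isUnit_F hp)).ne_zero) i j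

lemma contDiffOn_matF_inv_mul {f : ℝ × ℝ → Matrix (Fin 2) (Fin 2) ℂ}
    (hf : ∀ i j, ContDiffOn ℝ (k : WithTop ℕ∞) (fun p => f p i j) (regularSet ε μ ξ η Ω))
    (i j : Fin 2) : ContDiffOn ℝ (k : WithTop ℕ∞)
    (fun p => ((matF ε μ ξ η p)⁻¹ * f p) i j) (regularSet ε μ ξ η Ω) := by
  simp only [Matrix.mul_apply]
  exact ContDiffOn.sum fun a _ => (h.contDiffOn_matF_inv i a).mul (hf a j)

lemma isSolution_newPotential (hq : IsSolution k ε q Ω) :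
    IsSolution k ε (newPotential ε μ ξ η q) (regularSet ε μ ξ η Ω) := by
  refine ⟨h.contDiffOn_newPotential, fun p hp => (defectQ_reduction p).2 ?_⟩
  have hs : regularSet ε μ ξ η Ω ⊆ Ω := fun p hp => hp.1
  -- A generic `z` suffices: off `m` for `S(z)` to be regular, off `l` for it to be invertible, and
  -- nonzero because the curvature carries a factor `z`.
  obtain ⟨z, hz⟩ := ((Set.finite_range (pole μ)).union
    ((Set.finite_range (lam μ)).union (Set.finite_singleton 0))).exists_notMem
  simp only [Set.mem_union, Set.mem_range, Set.mem_singleton_iff, not_or, not_exists] at hz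
  obtain ⟨hz1, hz2, hz0⟩ := hz
  have hzp : ∀ α, z - pole μ α ≠ 0 := fun α => sub_ne_zero.2 (Ne.symm (hz1 α))
  have hzl : ∀ α, z - lam μ α ≠ 0 := fun α => sub_ne_zero.2 (Ne.symm (hz2 α))
  have cq := h.contDiffOn.of_le h.two_le'
  have cr := h.contDiffOn_reduction.of_le h.two_le'
  have cq' := h.contDiffOn_newPotential.of_le h.two_le'
  have cr' := NonlocalDNLS.contDiffOn_reduction (ε := ε) (fun p hp => h.reflect_mem hp) cq'
  obtain ⟨Ut, Vx, hU, hV, hZ⟩ := lax_curvature h.isOpen cq cr (hs hp) z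
  obtain ⟨Ut', Vx', hU', hV', hZ'⟩ := lax_curvature h.isOpen_regularSet cq' cr' hp z
  have hG : ∀ i j, ContDiffOn ℝ 2 (fun p => ((matF ε μ ξ η p)⁻¹ *
      dressS (lam μ) (pole μ) (matH ξ η p) (matK ε ξ η p) z) i j) (regularSet ε μ ξ η Ω) := by
    intro i j
    exact (h.contDiffOn_matF_inv_mul (fun a b => contDiffOn_const.sub
      (h.contDiffOn_dressX_mul _ a b)) i j).of_le h.two_le'
  have e := zero_curvature h.isOpen_regularSet hG (fun p hp => (h.intertwine hp hzp).1)
    (fun p hp => (h.intertwine hp hzp).2) hp hU hV hU' hV'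
  have hQ : defectQ q (reduction ε q) p = 0 := (defectQ_reduction p).1 (hq.2 p (hs hp))
  have hR : defectR q (reduction ε q) p = 0 := by
    rw [defectR_reduction h.eps h.isOpen h.symm cq (hs hp),
      (defectQ_reduction _).1 (hq.2 _ (h.symm p (hs hp))), map_zero, mul_zero]
  have hoff : offDiag 0 0 = 0 := by ext i j; fin_cases i <;> fin_cases j <;> rfl
  rw [hZ, hZ', hQ, hR, hoff, smul_zero, Matrix.mul_zero] at e
  have hS := dressS_mul_inverse h.lam_sub_pole (isUnit_iff_ne_zero.2 (h.gram_det_ne_zero hp)) z hzp hzl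
  have hunit : IsUnit ((matF ε μ ξ η p)⁻¹ *
      dressS (lam μ) (pole μ) (matH ξ η p) (matK ε ξ η p) z) :=
    ((Matrix.isUnit_nonsing_inv_iff).2 (h.isUnit_F hp)).mul (IsUnit.of_mul_eq_one _ hS)
  have e' := (hunit.mul_left_eq_zero).1 e
  have e01 := congrFun (congrFun e' 0) 1
  simpa [offDiag, hz0] using e01

end IsDarbouxData

/-! ### The Darboux matrix as a polynomial -/

open Polynomial in
/-- The polynomial `∏_γ (λ + λ_γ^*)`, the product running over a set of indices. -/
def polePoly (μ : Fin n → ℂ) (s : Finset (Fin n × Fin 2)) : ℂ[X] :=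
  ∏ γ ∈ s, (X - C (pole μ γ))

lemma polePoly_eval (s : Finset (Fin n × Fin 2)) (z : ℂ) :
    (polePoly μ s).eval z = ∏ γ ∈ s, (z - pole μ γ) := by
  simp [polePoly, Polynomial.eval_prod]

lemma natDegree_polePoly (s : Finset (Fin n × Fin 2)) : (polePoly μ s).natDegree = s.card :=
  Polynomial.natDegree_finsetProd_X_sub_C_eq_card s (pole μ)

lemma card_idx : (Finset.univ : Finset (Fin n × Fin 2)).card = 2 * n := by
  simp [mul_comm]

/-- The combination of a scalar and a vector of scalars from which the Darboux matrix is built. -/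
def darbouxComb (ε : ℂ) (μ : Fin n → ℂ) (ξ η : Fin n → ℝ × ℝ → ℂ) (c : ℂ)
    (w : Fin n × Fin 2 → ℂ) (p : ℝ × ℝ) : Matrix (Fin 2) (Fin 2) ℂ :=
  (matF ε μ ξ η p)⁻¹ * (c • 1 - dressX (lam μ) (pole μ) (matH ξ η p) (matK ε ξ η p) *
    (Matrix.diagonal w * matK ε ξ η p))

lemma darbouxComb_sum (N : ℕ) (x : ℕ → ℂ) (c : ℕ → ℂ) (w : ℕ → Fin n × Fin 2 → ℂ) (p : ℝ × ℝ) :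
    ∑ m : Fin N, x m • darbouxComb ε μ ξ η (c m) (w m) p =
      darbouxComb ε μ ξ η (∑ m ∈ Finset.range N, c m * x m)
        (fun β => ∑ m ∈ Finset.range N, w m β * x m) p := by
  rw [Fin.sum_univ_eq_sum_range (fun m => x m • darbouxComb ε μ ξ η (c m) (w m) p)]
  induction N with
  | zero =>
    have : (Matrix.diagonal fun _ : Fin n × Fin 2 => (0 : ℂ)) = 0 := Matrix.diagonal_zero
    simp [darbouxComb, this]
  | succ N ih =>
    simp only [Finset.sum_range_succ, ih]
    simp only [darbouxComb, ← Matrix.diagonal_add, Matrix.add_mul, Matrix.mul_add, add_smul,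
        Matrix.mul_sub]
    have hw : (Matrix.diagonal fun β => w N β * x N) = x N • Matrix.diagonal (w N) := by
      ext a b; simp [Matrix.diagonal_apply, mul_comm]
    rw [hw]
    simp only [Matrix.smul_mul, Matrix.mul_smul, smul_sub, mul_smul, smul_comm (x N) (c N)]
    abel

/-- The coefficients of the Darboux matrix. -/
def darbouxCoeff (ε : ℂ) (μ : Fin n → ℂ) (ξ η : Fin n → ℝ × ℝ → ℂ) (m : ℕ) :
    ℝ × ℝ → Matrix (Fin 2) (Fin 2) ℂ :=
  darbouxComb ε μ ξ η ((polePoly μ Finset.univ).coeff m)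
    (fun β => (polePoly μ (Finset.univ.erase β)).coeff m)

lemma sum_darbouxCoeff (z : ℂ) (p : ℝ × ℝ) :
    ∑ m : Fin (2 * n + 1), z ^ (m : ℕ) • darbouxCoeff ε μ ξ η m p =
      darbouxComb ε μ ξ η ((polePoly μ Finset.univ).eval z)
        (fun β => (polePoly μ (Finset.univ.erase β)).eval z) p := by
  have h := darbouxComb_sum (ε := ε) (μ := μ) (ξ := ξ) (η := η) (2 * n + 1) (fun m => z ^ m)
    (fun m => (polePoly μ Finset.univ).coeff m)
    (fun m β => (polePoly μ (Finset.univ.erase β)).coeff m) p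
  refine h.trans ?_
  congr 1
  · rw [Polynomial.eval_eq_sum_range' (n := 2 * n + 1)]
    rw [natDegree_polePoly, card_idx]; omega
  · funext β
    rw [Polynomial.eval_eq_sum_range' (n := 2 * n + 1)]
    rw [natDegree_polePoly]
    have := Finset.card_le_card (Finset.erase_subset β Finset.univ)
    rw [card_idx] at this
    omega

/-- Multiplying `(z - m_β)⁻¹` by the full product leaves the product with the factor `β` erased. At
a pole the right side is zero because of its prefactor, so only the left side is the polynomial
extension. -/
lemma sum_darbouxCoeff_of_regular {z : ℂ} (hz : ∀ α, z - pole μ α ≠ 0) (p : ℝ × ℝ) :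
    ∑ m : Fin (2 * n + 1), z ^ (m : ℕ) • darbouxCoeff ε μ ξ η m p =
      (∏ γ, (z - pole μ γ)) • ((matF ε μ ξ η p)⁻¹ *
        dressS (lam μ) (pole μ) (matH ξ η p) (matK ε ξ η p) z) := by
  rw [sum_darbouxCoeff, darbouxComb, ← Matrix.mul_smul]
  congr 1
  rw [dressS, smul_sub, polePoly_eval]
  congr 1
  rw [← Matrix.mul_smul, ← Matrix.smul_mul]
  congr 2
  ext α β
  by_cases hab : α = β
  · subst hab
    simp only [resolv, Matrix.smul_apply, Matrix.diagonal_apply_eq, smul_eq_mul]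
    rw [polePoly_eval, ← Finset.mul_prod_erase _ _ (Finset.mem_univ α)]
    have := hz α
    field_simp
  · simp [resolv, Matrix.diagonal_apply_ne _ hab]

/-- The full product is monic of degree `2n`, while the products with one factor erased have smaller
degree and do not contribute. -/
lemma darbouxCoeff_last (p : ℝ × ℝ) :
    darbouxCoeff ε μ ξ η (2 * n) p = (matF ε μ ξ η p)⁻¹ := by
  have h1 : (polePoly μ (Finset.univ : Finset (Fin n × Fin 2))).coeff (2 * n) = 1 := by
    rw [← card_idx, ← natDegree_polePoly (μ := μ)]
    exact Polynomial.monic_prod_of_monic _ _ fun γ _ => Polynomial.monic_X_sub_C _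
  have h2 : (fun β => (polePoly μ (Finset.univ.erase β)).coeff (2 * n)) = fun _ => 0 := by
    funext β
    refine Polynomial.coeff_eq_zero_of_natDegree_lt ?_
    rw [natDegree_polePoly, ← card_idx]
    exact Finset.card_erase_lt_of_mem (Finset.mem_univ β)
  have h3 : (Matrix.diagonal fun _ : Fin n × Fin 2 => (0 : ℂ)) = 0 := Matrix.diagonal_zero
  rw [darbouxCoeff, h1, h2, darbouxComb, h3]
  simp

namespace IsDarbouxData

variable (h : IsDarbouxData k ε Ω q μ ξ η)
include h

lemma contDiffOn_darbouxCoeff (m : ℕ) (i j : Fin 2) : ContDiffOn ℝ (k : WithTop ℕ∞)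
    (fun p => darbouxCoeff ε μ ξ η m p i j) (regularSet ε μ ξ η Ω) := by
  exact h.contDiffOn_matF_inv_mul (fun a b => contDiffOn_const.sub
    (h.contDiffOn_dressX_mul _ a b)) i j

lemma isDarboux : IsDarboux
    (fun z p => ∑ m : Fin (2 * n + 1), z ^ (m : ℕ) • darbouxCoeff ε μ ξ η m p)
    q (reduction ε q) (newPotential ε μ ξ η q) (reduction ε (newPotential ε μ ξ η q))
    (regularSet ε μ ξ η Ω) := by
  have hdc : ∀ (m : ℕ) (i j : Fin 2) (p), p ∈ regularSet ε μ ξ η Ω →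
      DifferentiableAt ℝ (fun p => darbouxCoeff ε μ ξ η m p i j) p := fun m i j p hp =>
    ((h.contDiffOn_darbouxCoeff m i j).contDiffAt (h.isOpen_regularSet.mem_nhds hp)).differentiableAt
      h.ne_zero
  have hent (z : ℂ) (i j : Fin 2) : (fun p => (∑ m : Fin (2 * n + 1),
      z ^ (m : ℕ) • darbouxCoeff ε μ ξ η m p) i j) =
      fun p => ∑ m : Fin (2 * n + 1), z ^ (m : ℕ) * darbouxCoeff ε μ ξ η m p i j := by
    funext p; simp [Matrix.sum_apply]
  intro z
  refine ⟨fun i j p hp => ?_, fun p hp => ?_⟩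
  · simp only [hent]
    exact (DifferentiableAt.fun_sum fun (m : Fin (2 * n + 1)) _ =>
      (hdc m i j p hp).const_mul (z ^ (m : ℕ))).differentiableWithinAt
  -- Both sides of each relation are continuous in `z`, so it suffices to compare them off the
  -- finite set of poles.
  · have hdense : Dense {z : ℂ | ∀ α, z - pole μ α ≠ 0} := by
      have h1 := (Set.finite_range (pole μ)).countable.dense_compl ℂ
      exact h1.mono fun z (hz : z ∉ Set.range (pole μ)) α h0 => hz ⟨α, (sub_eq_zero.1 h0).symm⟩
    have hmx (z : ℂ) : matDx (fun p => ∑ m : Fin (2 * n + 1),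
        z ^ (m : ℕ) • darbouxCoeff ε μ ξ η m p) p =
        ∑ m : Fin (2 * n + 1), z ^ (m : ℕ) • matDx (darbouxCoeff ε μ ξ η m) p := by
      ext i j
      simp only [matDx, Matrix.of_apply, Matrix.sum_apply, Matrix.smul_apply, smul_eq_mul]
      exact (HasDerivAt.fun_sum fun (m : Fin (2 * n + 1)) _ =>
        (hasDerivAt_dx (hdc m i j p hp)).const_mul (z ^ (m : ℕ))).deriv
    have hmt (z : ℂ) : matDt (fun p => ∑ m : Fin (2 * n + 1),
        z ^ (m : ℕ) • darbouxCoeff ε μ ξ η m p) p =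
        ∑ m : Fin (2 * n + 1), z ^ (m : ℕ) • matDt (darbouxCoeff ε μ ξ η m) p := by
      ext i j
      simp only [matDt, Matrix.of_apply, Matrix.sum_apply, Matrix.smul_apply, smul_eq_mul]
      exact (HasDerivAt.fun_sum fun (m : Fin (2 * n + 1)) _ =>
        (hasDerivAt_dt (hdc m i j p hp)).const_mul (z ^ (m : ℕ))).deriv
    have hcS (D : ℕ → Matrix (Fin 2) (Fin 2) ℂ) :
        Continuous fun z : ℂ => ∑ m : Fin (2 * n + 1), z ^ (m : ℕ) • D m := by fun_prop
    have hcU (q r : ℝ × ℝ → ℂ) : Continuous fun z : ℂ => laxU q r z p := by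
      simp only [laxU_eq]; fun_prop
    have hcV (q r : ℝ × ℝ → ℂ) : Continuous fun z : ℂ => laxV q r z p := by
      simp only [laxV_eq, laxU_eq]; fun_prop
    have hcG := hcS fun m => darbouxCoeff ε μ ξ η m p
    constructor
    · simp only [hmx]
      refine congrFun (Continuous.ext_on hdense ((hcG.matrix_mul (hcU q (reduction ε q))).add
        (hcS fun m => matDx (darbouxCoeff ε μ ξ η m) p))
        ((hcU (newPotential ε μ ξ η q) (reduction ε (newPotential ε μ ξ η q))).matrix_mul hcG) fun z hz => ?_) z
      have h1 := (h.intertwine hp hz).1.const_smul (∏ γ, (z - pole μ γ))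
      simp only [← sum_darbouxCoeff_of_regular hz] at h1
      have h2 := HasMatDerivAt.matDx_eq (G := fun p => ∑ m : Fin (2 * n + 1),
        z ^ (m : ℕ) • darbouxCoeff ε μ ξ η m p) h1
      simp only [Pi.add_apply, ← hmx]
      rw [h2]
      simp only [sum_darbouxCoeff_of_regular hz]
      rw [smul_sub, Matrix.mul_smul, Matrix.smul_mul]
      abel
    · simp only [hmt]
      refine congrFun (Continuous.ext_on hdense ((hcG.matrix_mul (hcV q (reduction ε q))).add
        (hcS fun m => matDt (darbouxCoeff ε μ ξ η m) p))
        ((hcV (newPotential ε μ ξ η q) (reduction ε (newPotential ε μ ξ η q))).matrix_mul hcG) fun z hz => ?_) z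
      have h1 := (h.intertwine hp hz).2.const_smul (∏ γ, (z - pole μ γ))
      simp only [← sum_darbouxCoeff_of_regular hz] at h1
      have h2 := HasMatDerivAt.matDt_eq (G := fun p => ∑ m : Fin (2 * n + 1),
        z ^ (m : ℕ) • darbouxCoeff ε μ ξ η m p) h1
      simp only [Pi.add_apply, ← hmt]
      rw [h2]
      simp only [sum_darbouxCoeff_of_regular hz]
      rw [smul_sub, Matrix.mul_smul, Matrix.smul_mul]
      abel

end IsDarbouxData

end

end NonlocalDNLS

end

theorem mainTheorem1 (k : ℕ∞) (hk : 2 ≤ k) (ε : ℂ) (hε : ε = 1 ∨ ε = -1)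
    (Ω : Set (ℝ × ℝ)) (hΩ : IsOpen Ω) (hΩsymm : ∀ p ∈ Ω, NonlocalDNLS.reflect p ∈ Ω)
    (q : ℝ × ℝ → ℂ) (hq : NonlocalDNLS.IsSolution k ε q Ω)
    (n : ℕ) (μ : Fin n → ℂ)
    (hμ : ∀ j, (μ j ^ 2).im ≠ 0)
    (hμμ : ∀ i j, i ≠ j → starRingEnd ℂ (μ i) ^ 2 ≠ μ j ^ 2)
    (ξ η : Fin n → ℝ × ℝ → ℂ)
    (hh : ∀ j, NonlocalDNLS.IsLaxSolution q (NonlocalDNLS.reduction ε q) (μ j) (ξ j) (η j) Ω) :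
    -- the regular set, on which `Γ` is invertible, is an admissible domain for the equation
    IsOpen (NonlocalDNLS.regularSet ε μ ξ η Ω) ∧
    (∀ p ∈ NonlocalDNLS.regularSet ε μ ξ η Ω,
      NonlocalDNLS.reflect p ∈ NonlocalDNLS.regularSet ε μ ξ η Ω) ∧
    -- `F` is diagonal and invertible
    (∀ p ∈ NonlocalDNLS.regularSet ε μ ξ η Ω,
      (NonlocalDNLS.matF ε μ ξ η p).IsDiag ∧ IsUnit (NonlocalDNLS.matF ε μ ξ η p)) ∧
    -- `G(λ)` is a polynomial of degree `2n` in `λ` with leading coefficient `F⁻¹`, and it is a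
    -- Darboux matrix, for all `λ`, between the Lax pairs of `q` and of the new potential, both
    -- subject to the nonlocal reduction
    (∃ C : Fin (2 * n + 1) → ℝ × ℝ → Matrix (Fin 2) (Fin 2) ℂ,
      (∀ m i j, ContDiffOn ℝ (k : WithTop ℕ∞) (fun p => C m p i j)
        (NonlocalDNLS.regularSet ε μ ξ η Ω)) ∧
      (∀ p ∈ NonlocalDNLS.regularSet ε μ ξ η Ω,
        C (Fin.last (2 * n)) p = (NonlocalDNLS.matF ε μ ξ η p)⁻¹ ∧
        ∀ z : ℂ, (∀ γ, z + starRingEnd ℂ (NonlocalDNLS.lam μ γ) ≠ 0) →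
          NonlocalDNLS.matG ε μ ξ η z p = ∑ m : Fin (2 * n + 1), z ^ (m : ℕ) • C m p) ∧
      NonlocalDNLS.IsDarboux (fun z p => ∑ m : Fin (2 * n + 1), z ^ (m : ℕ) • C m p)
        q (NonlocalDNLS.reduction ε q)
        (NonlocalDNLS.newPotential ε μ ξ η q)
        (NonlocalDNLS.reduction ε (NonlocalDNLS.newPotential ε μ ξ η q))
        (NonlocalDNLS.regularSet ε μ ξ η Ω)) ∧
    -- the new potential is again a solution
    NonlocalDNLS.IsSolution k ε (NonlocalDNLS.newPotential ε μ ξ η q)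
      (NonlocalDNLS.regularSet ε μ ξ η Ω) := by 
  have h : NonlocalDNLS.IsDarbouxData k ε Ω q μ ξ η := ⟨hk, hε, hΩ, hΩsymm, hq.1, hμ, hμμ, hh⟩
  refine ⟨h.isOpen_regularSet, fun p hp => h.reflect_mem hp,
    fun p hp => ⟨NonlocalDNLS.matF_isDiag ε μ ξ η p, h.isUnit_F hp⟩,
    ⟨fun m => NonlocalDNLS.darbouxCoeff ε μ ξ η m, fun m i j => h.contDiffOn_darbouxCoeff m i j,
      fun p _ => ⟨NonlocalDNLS.darbouxCoeff_last p, fun z hz => ?_⟩, h.isDarboux⟩,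
    h.isSolution_newPotential hq⟩
  rw [NonlocalDNLS.matG_eq]
  exact (NonlocalDNLS.sum_darbouxCoeff_of_regular
    (fun γ => by rw [NonlocalDNLS.pole, sub_neg_eq_add]; exact hz γ) p).symm
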